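/- A word $w=w_1\cdots w_n$ over the positive integers is \emph{packed} if its set of letters is $\{1,\dots,r\}$ for some $r$. For positions $i<j$ put $\mathrm{inv}_w(i,j)=1$ if $w_i>w_j$, $\tfrac12$ if $w_i=w_j$, and $0$ if $w_i<w_j$. The \emph{pseudo-permutohedron} of degree $n$ is the set of packed words of length $n$, partially ordered by $u\preceq v$ iff $\mathrm{inv}_u(i,j)\le \mathrm{inv}_v(i,j)$ for all $i<j$. A \emph{plane tree} here is a plane rooted tree in which every internal vertex has at least two children. With a word $w$ one associates a plane tree $\mathcal T(w)$: the empty word gives the single leaf; if $w\neq\varepsilon$ has greatest letter $m$ and $w=v_1\,m\,v_2\,m\cdots m\,v_k$ with (possibly empty) words $v_i$ not containing $m$, then $\mathcal T(w)$ is obtained by grafting $\mathcal T(v_1),\dots,\mathcal T(v_k)$, in this order, on a common root. Write $u\sim_T v$ iff $\mathcal T(u)=\mathcal T(v)$. \textbf{Theorem.} Let $n\ge 0$ and consider the $\sim_T$-classes of packed words of length $n$. (a) $\mathcal T$ induces a bijection from these classes to the plane trees with $n+1$ leaves, and every class $S$ has a greatest element in the pseudo-permutohedron, its \emph{canonical word}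 $c(S)$. (b) For classes $S,S'$ the following are equivalent: (1) $c(S)\preceq c(S')$; (2) there are $w\in S$ and $w'\in S'$ with $w\preceq w'$; (3) $\mathcal T(S)\le \mathcal T(S')$ in the Palacios--Ronco order on plane trees, that is, $\mathcal T(S')$ can be obtained from $\mathcal T(S)$ by a finite (possibly empty) sequence of moves, each of which, at some vertex, either contracts the edge from this vertex to its leftmost child (which must be internal), or performs the inverse of the contraction of the edge from a vertex to its rightmost (internal) child. The relation on classes so defined is a partial order. (c) The set of canonical words of length $n$, with the order induced from the pseudo-permutohedron, is a lattice. -/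

import Mathlib

namespace PackedTrees

/-! ### Packed words and the pseudo-permutohedron -/

/-- A word `w₁ ⋯ wₙ` over the positive integers is packed if its set of letters is an initial
interval `{1, …, r}`: whenever a letter occurs, all smaller positive integers occur. -/
def IsPacked {n : ℕ} (w : Fin n → ℕ) : Prop :=
  (∀ i, 1 ≤ w i) ∧ ∀ i m, 1 ≤ m → m ≤ w i → ∃ j, w j = m

/-- Packed words of length `n`, i.e. ordered set partitions of `{1, …, n}`
(`i` lies in the block number `w i`). -/
def PackedWord (n : ℕ) : Type := {w : Fin n → ℕ // IsPacked w}

/-- The value of the pair of positions `(i, j)`, `i < j`, in the table of inversions: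
`1` if the block of `i` is strictly to the right of the block of `j` (full inversion),
`1/2` if `i` and `j` are in the same block (half inversion), and `0` otherwise. -/
def inversion {n : ℕ} (w : PackedWord n) (i j : Fin n) : ℚ :=
  if w.1 j < w.1 i then 1 else if w.1 i = w.1 j then 1 / 2 else 0

theorem lt_of_inversion_eq {n : ℕ} {u v : PackedWord n}
    (h : ∀ i j, i < j → inversion u i j = inversion v i j) (i j : Fin n)
    (hij : u.1 j < u.1 i) : v.1 j < v.1 i := by
  rcases lt_trichotomy i j with h1 | h1 | h1
  · have := h i j h1
    unfold inversion at this
    rw [if_pos hij] at this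
    by_contra hc
    rw [if_neg hc] at this
    split_ifs at this <;> norm_num at this
  · subst h1
    omega
  · have := h j i h1
    unfold inversion at this
    rw [if_neg (by omega), if_neg (by omega)] at this
    by_contra hc
    split_ifs at this
    · norm_num at this
    · norm_num at this
    · omega

theorem le_of_inversion_eq {n : ℕ} {u v : PackedWord n}
    (h : ∀ i j, i < j → inversion u i j = inversion v i j) (i : Fin n) : u.1 i ≤ v.1 i := by
  have key : ∀ m, ∀ i, u.1 i = m → m ≤ v.1 i := by
    intro m
    induction m with
    | zero => intro i _; omega
    | succ m ih =>
      intro i hi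
      rcases Nat.eq_zero_or_pos m with h0 | h0
      · have := v.2.1 i
        omega
      · obtain ⟨j, hj⟩ := u.2.2 i m h0 (by omega)
        have h1 := ih j hj
        have h2 := lt_of_inversion_eq h i j (by omega)
        omega
  exact key _ i rfl

/-- The pseudo-permutohedron: `u ≤ v` if every entry of the table of inversions of `u` is at
most the corresponding entry of the table of inversions of `v`. -/
instance (n : ℕ) : PartialOrder (PackedWord n) where
  le u v := ∀ i j, i < j → inversion u i j ≤ inversion v i j
  le_refl _ _ _ _ := le_rfl
  le_trans _ _ _ h₁ h₂ i j h := (h₁ i j h).trans (h₂ i j h)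
  le_antisymm u v h₁ h₂ := by
    have h : ∀ i j, i < j → inversion u i j = inversion v i j :=
      fun i j hij => le_antisymm (h₁ i j hij) (h₂ i j hij)
    exact Subtype.ext (funext fun i =>
      le_antisymm (le_of_inversion_eq h i)
        (le_of_inversion_eq (fun i j hij => (h i j hij).symm) i))

/-! ### Plane trees -/

/-- Plane trees in which every internal vertex has at least two children:
`node l m r` is the tree whose root has leftmost child `l`, rightmost child `r` and, between
them, the (possibly empty) list `m` of children. -/
inductive PlaneTree : Type
  | leaf : PlaneTree
  | node (l : PlaneTree) (m : List PlaneTree) (r : PlaneTree) : PlaneTree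

namespace PlaneTree

/-- The number of leaves of a plane tree. -/
def leaves : PlaneTree → ℕ
  | leaf => 1
  | node l m r => l.leaves + (m.map leaves).sum + r.leaves

/-- Graft the trees of a list, in this order, on a common root.  Only used for lists of length
at least two. -/
def graft : List PlaneTree → PlaneTree
  | [] => leaf
  | [t] => t
  | t :: t' :: ts => node t (t' :: ts).dropLast ((t' :: ts).getLast (List.cons_ne_nil _ _))

/-- The moves generating the Palacios–Ronco order: contract the edge from an internal vertex to
its leftmost child (when this child is internal), or replace a vertex by two vertices, the new one
becoming the rightmost child of the old one (the inverse of contracting the edge to a rightmost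
child); the moves may be performed at any vertex of the tree. -/
inductive Move : PlaneTree → PlaneTree → Prop
  | contractLeft (a : PlaneTree) (m : List PlaneTree) (b : PlaneTree) (m' : List PlaneTree)
      (r : PlaneTree) : Move (node (node a m b) m' r) (node a (m ++ b :: m') r)
  | splitRight (l : PlaneTree) (m : List PlaneTree) (a : PlaneTree) (m' : List PlaneTree)
      (b : PlaneTree) : Move (node l (m ++ a :: m') b) (node l m (node a m' b))
  | inLeft {l l' : PlaneTree} (m : List PlaneTree) (r : PlaneTree) :
      Move l l' → Move (node l m r) (node l' m r)
  | inMiddle (l : PlaneTree) (m : List PlaneTree) {t t' : PlaneTree} (m' : List PlaneTree)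
      (r : PlaneTree) : Move t t' → Move (node l (m ++ t :: m') r) (node l (m ++ t' :: m') r)
  | inRight (l : PlaneTree) (m : List PlaneTree) {r r' : PlaneTree} :
      Move r r' → Move (node l m r) (node l m r')

/-- The Palacios–Ronco order on plane trees: the reflexive transitive closure of the moves. -/
def PalaciosRoncoLE : PlaneTree → PlaneTree → Prop := Relation.ReflTransGen Move

end PlaneTree

/-! ### The plane tree of a word -/

theorem length_le_of_mem_splitOn (a : ℕ) (l : List ℕ) :
    ∀ v ∈ l.splitOn a, v.length ≤ l.length ∧ (a ∈ l → v.length < l.length) := by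
  induction l with
  | nil => simp [List.splitOn_nil]
  | cons x xs ih =>
    rw [List.splitOn_cons_eq_if_modifyHead]
    by_cases hx : x = a
    · subst hx
      simp only [beq_self_eq_true, if_true, List.mem_cons, List.length_cons]
      rintro v (rfl | hv)
      · simp
      · have := (ih v hv).1
        exact ⟨by omega, fun _ => by omega⟩
    · have hx' : ¬ a = x := fun h => hx h.symm
      simp only [beq_iff_eq, hx, if_false, List.mem_cons, hx', false_or, List.length_cons]
      cases hL : xs.splitOn a with
      | nil => simp
      | cons h t =>
        rw [hL] at ih
        simp only [List.modifyHead_cons, List.mem_cons]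
        rintro v (rfl | hv)
        · have := ih h (by simp)
          simp only [List.length_cons]
          exact ⟨by omega, fun hm => by have := this.2 hm; omega⟩
        · have := ih v (by simp [hv])
          exact ⟨by omega, fun hm => by have := this.2 hm; omega⟩

theorem length_lt_of_mem_splitOn {a : ℕ} {v l : List ℕ} (ha : a ∈ l) (hv : v ∈ l.splitOn a) :
    v.length < l.length :=
  (length_le_of_mem_splitOn a l v hv).2 ha

theorem foldr_max_mem (a : ℕ) (l : List ℕ) : (a :: l).foldr max 0 ∈ a :: l := by
  induction l generalizing a with
  | nil => simp
  | cons b l ih =>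
    have h := ih b
    rw [List.foldr_cons]
    rcases max_choice a ((b :: l).foldr max 0) with h' | h'
    · rw [h']
      exact List.mem_cons_self
    · rw [h']
      exact List.mem_cons_of_mem _ h

/-- The plane tree of a word: the empty word gives the leaf, and a nonempty word with greatest
letter `m`, written `w = v₁ m v₂ m ⋯ m vₖ` with the (possibly empty) words `vᵢ` not containing
`m`, gives the tree obtained by grafting the trees of `v₁, …, vₖ` on a common root. -/
def treeOfList : List ℕ → PlaneTree
  | [] => PlaneTree.leaf
  | a :: l =>
    PlaneTree.graft
      (((a :: l).splitOn ((a :: l).foldr max 0)).attach.map fun v => treeOfList v.1)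
termination_by w => w.length
decreasing_by exact length_lt_of_mem_splitOn (foldr_max_mem a l) v.2

/-- The plane tree of a packed word. -/
def tree {n : ℕ} (w : PackedWord n) : PlaneTree := treeOfList (List.ofFn w.1)

/-! ### Classes of packed words with the same plane tree -/

/-- Two packed words of length `n` are equivalent if they have the same plane tree. -/
def treeSetoid (n : ℕ) : Setoid (PackedWord n) where
  r u v := tree u = tree v
  iseqv := ⟨fun _ => rfl, fun h => h.symm, fun h₁ h₂ => h₁.trans h₂⟩

/-- The classes of packed words of length `n` with the same plane tree. -/
def TreeClass (n : ℕ) : Type := Quotient (treeSetoid n)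

namespace TreeClass

/-- The words of a class. -/
def words {n : ℕ} (S : TreeClass n) : Set (PackedWord n) :=
  {w | Quotient.mk (treeSetoid n) w = S}

/-- The common plane tree of the words of a class. -/
def planeTree {n : ℕ} (S : TreeClass n) : PlaneTree :=
  Quotient.lift tree (fun _ _ h => h) S

/-- `w` is the canonical word of the class `S`: the maximum of `S` in the pseudo-permutohedron. -/
def IsCanonical {n : ℕ} (S : TreeClass n) (w : PackedWord n) : Prop :=
  IsGreatest S.words w

/-- First order on classes: comparison of the canonical words. -/
def CanonicalLE {n : ℕ} (S S' : TreeClass n) : Prop :=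
  ∃ w w', S.IsCanonical w ∧ S'.IsCanonical w' ∧ w ≤ w'

/-- Second order on classes: existence of a comparable pair of representatives. -/
def PairLE {n : ℕ} (S S' : TreeClass n) : Prop :=
  ∃ w ∈ S.words, ∃ w' ∈ S'.words, w ≤ w'

end TreeClass

/-- The canonical words of length `n`, ordered as in the pseudo-permutohedron. -/
abbrev CanonicalWord (n : ℕ) : Type :=
  {w : PackedWord n // ∃ S : TreeClass n, S.IsCanonical w}

end PackedTrees

namespace PackedTrees

/-! ### Grafting and the Palacios–Ronco order -/

namespace PlaneTree

/-! The core is the cycle (1) ⇒ (2) ⇒ (3) ⇒ (1); the first implication is immediate.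

(2) ⇒ (3) (`treeOfList_le_of_pairwise`): for comparable words, cut both at the last occurrence of
the greatest letter `M` of the upper word. If `a` is the lower letter there, every earlier lower
letter is at most `a`, and earlier positions with lower letter `a` have upper letter `M`. Moves
carry the lower tree to the one whose root separates the subtrees of the prefix at `a`, with the
whole suffix as last subtree (`treeOfList_le_graft`). Induction compares the factors, and
contractions on the left account for positions where `M` occurs only above.

(3) ⇒ (1): a canonical word is built by joining canonical words of the subtrees with a new greatest
letter, all letters of a factor exceeding those of later factors (`IsMaxWord.intercalate`). Each
move lifts to a pair of comparable words whose lower member is canonical (`Realizable.of_move`): a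
contraction raises the separators of a prefix to the greatest letter, a splitting lowers the
separators of a suffix. Since the lower member dominates its class, these pairs chain along a
sequence of moves (`exists_le_of_palaciosRoncoLE`).

For (c), the packed words form a lattice: joins come from transitive closures of inversions, meets
from joins by reversing words. By (2) ⇒ (1), sending a word to the canonical word of its class is a
closure operator (`exists_canonicalWord`); its closed elements inherit the lattice property. -/

theorem graft_cons_append (l : PlaneTree) (m : List PlaneTree) (r : PlaneTree) :
    graft (l :: (m ++ [r])) = node l m r := by
  cases m with
  | nil => simp [graft]
  | cons a m =>
    rw [List.cons_append, graft]
    congr 1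
    · rw [← List.cons_append, List.dropLast_concat]
    · simp

theorem exists_eq_cons_append {α : Type*} {ts : List α} (h : 2 ≤ ts.length) :
    ∃ l m r, ts = l :: (m ++ [r]) := by
  obtain _ | ⟨l, ts⟩ := ts
  · simp at h
  · rcases List.eq_nil_or_concat' ts with rfl | ⟨m, r, rfl⟩
    · simp at h
    · exact ⟨l, m, r, rfl⟩

theorem graft_injective {ts ts' : List PlaneTree} (h : 2 ≤ ts.length) (h' : 2 ≤ ts'.length)
    (e : graft ts = graft ts') : ts = ts' := by
  obtain ⟨l, m, r, rfl⟩ := exists_eq_cons_append h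
  obtain ⟨l', m', r', rfl⟩ := exists_eq_cons_append h'
  rw [graft_cons_append, graft_cons_append] at e
  injection e with e₁ e₂ e₃
  rw [e₁, e₂, e₃]

theorem graft_ne_leaf {ts : List PlaneTree} (h : 2 ≤ ts.length) : graft ts ≠ leaf := by
  obtain ⟨l, m, r, rfl⟩ := exists_eq_cons_append h
  rw [graft_cons_append]
  exact fun e => by injection e

theorem leaves_graft {ts : List PlaneTree} (h : ts ≠ []) :
    (graft ts).leaves = (ts.map leaves).sum := by
  by_cases h2 : 2 ≤ ts.length
  · obtain ⟨l, m, r, rfl⟩ := exists_eq_cons_append h2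
    rw [graft_cons_append, leaves]
    simp [add_assoc]
  · obtain _ | ⟨t, _ | ⟨t', ts⟩⟩ := ts
    · exact absurd rfl h
    · simp [graft]
    · simp at h2

theorem leaves_pos (t : PlaneTree) : 1 ≤ t.leaves := by
  fun_induction leaves t with
  | case1 => exact le_rfl
  | case2 l m r ihl _ _ => omega

namespace PalaciosRoncoLE

theorem refl (t : PlaneTree) : PalaciosRoncoLE t t := Relation.ReflTransGen.refl

theorem trans {a b c : PlaneTree} (h : PalaciosRoncoLE a b) (h' : PalaciosRoncoLE b c) :
    PalaciosRoncoLE a c := Relation.ReflTransGen.trans h h'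

/-- Contracting the edge to the leftmost child, or doing nothing if `xs` has only one tree. -/
theorem contract {xs ys : List PlaneTree} (hx : xs ≠ []) (hy : ys ≠ []) :
    PalaciosRoncoLE (graft (graft xs :: ys)) (graft (xs ++ ys)) := by
  by_cases h2 : 2 ≤ xs.length
  · obtain ⟨a, m, b, rfl⟩ := exists_eq_cons_append h2
    rcases List.eq_nil_or_concat' ys with rfl | ⟨m', r, rfl⟩
    · exact absurd rfl hy
    · have e : a :: (m ++ [b]) ++ (m' ++ [r]) = a :: ((m ++ b :: m') ++ [r]) := by simp
      rw [e, graft_cons_append, graft_cons_append, graft_cons_append]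
      exact .single (.contractLeft a m b m' r)
  · obtain _ | ⟨t, _ | ⟨t', ts⟩⟩ := xs
    · exact absurd rfl hx
    · exact refl _
    · simp at h2

/-- Splitting off a new rightmost child, or doing nothing if `ys` has only one tree. -/
theorem split {xs ys : List PlaneTree} (hx : xs ≠ []) (hy : ys ≠ []) :
    PalaciosRoncoLE (graft (xs ++ ys)) (graft (xs ++ [graft ys])) := by
  by_cases h2 : 2 ≤ ys.length
  · obtain ⟨a, m', b, rfl⟩ := exists_eq_cons_append h2
    obtain _ | ⟨l, m⟩ := xs
    · exact absurd rfl hx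
    · have e : l :: m ++ a :: (m' ++ [b]) = l :: ((m ++ a :: m') ++ [b]) := by simp
      rw [e, List.cons_append, graft_cons_append, graft_cons_append, graft_cons_append]
      exact .single (.splitRight l m a m' b)
  · obtain _ | ⟨t, _ | ⟨t', ts⟩⟩ := ys
    · exact absurd rfl hy
    · exact refl _
    · simp at h2

theorem graft_child {t t' : PlaneTree} (h : PalaciosRoncoLE t t') (xs ys : List PlaneTree) :
    PalaciosRoncoLE (graft (xs ++ t :: ys)) (graft (xs ++ t' :: ys)) := by
  induction h with
  | refl => exact refl _
  | @tail a b _ hab ih =>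
  refine ih.trans ?_
  obtain _ | ⟨l, m⟩ := xs
  · rcases List.eq_nil_or_concat' ys with rfl | ⟨m', r, rfl⟩
    · exact .single hab
    · simp only [List.nil_append, graft_cons_append]
      exact .single (.inLeft m' r hab)
  · rcases List.eq_nil_or_concat' ys with rfl | ⟨m', r, rfl⟩
    · simp only [List.cons_append, graft_cons_append]
      exact .single (.inRight l m hab)
    · simp only [List.cons_append]
      simp only [← List.cons_append, ← List.append_assoc]
      simp only [List.cons_append, graft_cons_append]
      exact .single (.inMiddle l m m' r hab)

theorem graft_congr_append {ts ts' : List PlaneTree} (h : List.Forall₂ PalaciosRoncoLE ts ts')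
    (xs : List PlaneTree) : PalaciosRoncoLE (graft (xs ++ ts)) (graft (xs ++ ts')) := by
  induction h generalizing xs with
  | nil => exact refl _
  | @cons t t' ts ts' ht _ ih =>
    have := ih (xs ++ [t'])
    simp only [List.append_assoc, List.singleton_append] at this
    exact (graft_child ht xs ts).trans this

theorem graft_congr {ts ts' : List PlaneTree} (h : List.Forall₂ PalaciosRoncoLE ts ts') :
    PalaciosRoncoLE (graft ts) (graft ts') := graft_congr_append h []

end PalaciosRoncoLE

end PlaneTree

open PlaneTree

/-! ### The tree of a word and its decomposition at a letter -/

/-- The trees of the factors of `w` between the occurrences of `M`. -/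
def subtrees (M : ℕ) (w : List ℕ) : List PlaneTree := (w.splitOn M).map treeOfList

theorem subtrees_ne_nil (M : ℕ) (w : List ℕ) : subtrees M w ≠ [] := by
  simp [subtrees, List.splitOn_ne_nil]

theorem subtrees_append_cons (M : ℕ) (u v : List ℕ) :
    subtrees M (u ++ M :: v) = subtrees M u ++ subtrees M v := by
  rw [subtrees, List.splitOn_append_cons_self, List.map_append, subtrees, subtrees]

theorem subtrees_of_notMem {M : ℕ} {w : List ℕ} (h : M ∉ w) : subtrees M w = [treeOfList w] := by
  rw [subtrees, List.splitOn_eq_singleton h, List.map_singleton]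

theorem two_le_length_subtrees {M : ℕ} {w : List ℕ} (h : M ∈ w) : 2 ≤ (subtrees M w).length := by
  obtain ⟨u, v, rfl⟩ := List.append_of_mem h
  rw [subtrees_append_cons, List.length_append]
  have h₁ := List.length_pos_of_ne_nil (subtrees_ne_nil M u)
  have h₂ := List.length_pos_of_ne_nil (subtrees_ne_nil M v)
  omega

@[simp] theorem treeOfList_nil : treeOfList [] = leaf := by rw [treeOfList]

theorem le_foldr_max {l : List ℕ} {x : ℕ} (h : x ∈ l) : x ≤ l.foldr max 0 :=
  List.le_max_of_le' 0 h le_rfl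

/-- The bound `M` need not occur in `w`: then there is a single factor, and grafting a single tree
returns that tree. This spares many case distinctions later. -/
theorem treeOfList_eq_graft {M : ℕ} {w : List ℕ} (h : ∀ x ∈ w, x ≤ M) :
    treeOfList w = graft (subtrees M w) := by
  by_cases hM : M ∈ w
  · have hm : w.foldr max 0 = M := by
      obtain _ | ⟨a, l⟩ := w
      · simp at hM
      · exact le_antisymm (h _ (foldr_max_mem a l)) (le_foldr_max hM)
    obtain _ | ⟨a, l⟩ := w
    · simp at hM
    · rw [treeOfList, hm, List.attach_map_val (f := treeOfList)]
      rfl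
  · rw [subtrees_of_notMem hM]
    rfl

theorem mem_of_mem_splitOn {a x : ℕ} {v l : List ℕ} (hv : v ∈ l.splitOn a) (hx : x ∈ v) :
    x ∈ l ∧ x ≠ a := by
  induction h : l.length using Nat.strong_induction_on generalizing l with
  | _ N ih =>
    subst h
    by_cases ha : a ∈ l
    · obtain ⟨p, q, rfl⟩ := List.append_of_mem ha
      rw [List.splitOn_append_cons_self, List.mem_append] at hv
      rcases hv with hv | hv
      · have := ih p.length (by simp) hv rfl
        exact ⟨by simp [this.1], this.2⟩
      · have := ih q.length (by simp; omega) hv rfl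
        exact ⟨by simp [this.1], this.2⟩
    · rw [List.splitOn_eq_singleton ha, List.mem_singleton] at hv
      subst hv
      exact ⟨hx, fun e => ha (e ▸ hx)⟩

theorem exists_max_mem {w : List ℕ} (h : w ≠ []) : ∃ M ∈ w, ∀ x ∈ w, x ≤ M := by
  obtain _ | ⟨a, l⟩ := w
  · exact absurd rfl h
  · exact ⟨_, foldr_max_mem a l, fun x hx => le_foldr_max hx⟩

theorem leaves_treeOfList (w : List ℕ) : (treeOfList w).leaves = w.length + 1 := by
  induction h : w.length using Nat.strong_induction_on generalizing w with
  | _ N ih =>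
    subst h
    by_cases hw : w = []
    · subst hw
      simp [leaves]
    · obtain ⟨M, hM, hle⟩ := exists_max_mem hw
      rw [treeOfList_eq_graft hle, leaves_graft (subtrees_ne_nil _ _)]
      -- The statement is extended to subwords cut at `M`; a factor without `M` is strictly shorter
      -- than `w`, so the outer induction applies to it.
      have key : ∀ v : List ℕ, v.length ≤ w.length → (M ∉ v → v.length < w.length) →
          ((subtrees M v).map leaves).sum = v.length + 1 := by
        intro v
        induction h : v.length using Nat.strong_induction_on generalizing v with
        | _ K ihK =>
          subst h
          intro h₁ h₂
          by_cases hv : M ∈ v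
          · obtain ⟨p, q, rfl⟩ := List.append_of_mem hv
            simp only [List.length_append, List.length_cons] at h₁ ⊢
            rw [subtrees_append_cons, List.map_append, List.sum_append,
              ihK p.length (by simp) p rfl (by omega) (by omega),
              ihK q.length (by simp; omega) q rfl (by omega) (by omega)]
            omega
          · rw [subtrees_of_notMem hv]
            simpa using ih v.length (h₂ hv) v rfl
      exact key w le_rfl fun h => absurd hM h

/-- The tree depends only on the relative order of the letters, so letters may be shifted or packed
freely. -/
theorem treeOfList_map {f : ℕ → ℕ} {w : List ℕ} (hf : StrictMonoOn f {x | x ∈ w}) :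
    treeOfList (w.map f) = treeOfList w := by
  induction h : w.length using Nat.strong_induction_on generalizing w with
  | _ N ih =>
    subst h
    by_cases hw : w = []
    · subst hw
      simp
    · obtain ⟨M, hM, hle⟩ := exists_max_mem hw
      have hle' : ∀ x ∈ w.map f, x ≤ f M := by
        intro x hx
        obtain ⟨y, hy, rfl⟩ := List.mem_map.1 hx
        exact hf.monotoneOn hy hM (hle y hy)
      rw [treeOfList_eq_graft hle, treeOfList_eq_graft hle']
      have key : ∀ v : List ℕ, (∀ x ∈ v, x ∈ w) → v.length ≤ w.length →
          (M ∉ v → v.length < w.length) → subtrees (f M) (v.map f) = subtrees M v := by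
        intro v
        induction h : v.length using Nat.strong_induction_on generalizing v with
        | _ K ihK =>
          subst h
          intro hvw h₁ h₂
          by_cases hv : M ∈ v
          · obtain ⟨p, q, rfl⟩ := List.append_of_mem hv
            simp only [List.length_append, List.length_cons] at h₁
            rw [List.map_append, List.map_cons, subtrees_append_cons, subtrees_append_cons,
              ihK p.length (by simp) p rfl (fun x hx => hvw x (by simp [hx])) (by omega)
                (by omega),
              ihK q.length (by simp; omega) q rfl (fun x hx => hvw x (by simp [hx])) (by omega)
                (by omega)]
          · have hv' : f M ∉ v.map f := by
              intro hm
              obtain ⟨y, hy, e⟩ := List.mem_map.1 hm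
              exact hv (hf.injOn (hvw y hy) hM e ▸ hy)
            rw [subtrees_of_notMem hv, subtrees_of_notMem hv',
              ih v.length (h₂ hv) (hf.mono fun x hx => hvw x hx) rfl]
      rw [key w (fun x hx => hx) le_rfl fun h => absurd hM h]


/-! ### Comparable words have comparable trees -/

/-- A list of pairs is pairwise related by `InvLE` if and only if the word of the first
components is below the word of the second components in the pseudo-permutohedron. -/
def InvLE (p q : ℕ × ℕ) : Prop := (q.1 ≤ p.1 → q.2 ≤ p.2) ∧ (q.1 < p.1 → q.2 < p.2)

theorem exists_last_max {α : Type*} (f : α → ℕ) {l : List α} (h : l ≠ []) :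
    ∃ l₁ x l₂, l = l₁ ++ x :: l₂ ∧ (∀ y ∈ l₁, f y ≤ f x) ∧ ∀ y ∈ l₂, f y < f x := by
  induction l with
  | nil => exact absurd rfl h
  | cons a l ih =>
    by_cases hl : l = []
    · subst hl
      exact ⟨[], a, [], rfl, by simp, by simp⟩
    · obtain ⟨l₁, x, l₂, rfl, h₁, h₂⟩ := ih hl
      by_cases hax : f a ≤ f x
      · exact ⟨a :: l₁, x, l₂, rfl, by simpa [hax] using h₁, h₂⟩
      · refine ⟨[], a, l₁ ++ x :: l₂, rfl, by simp, fun y hy => ?_⟩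
        rcases List.mem_append.1 hy with hy | hy
        · have := h₁ y hy
          omega
        · rcases List.mem_cons.1 hy with rfl | hy
          · omega
          · have := h₂ y hy
            omega

theorem exists_first {α : Type*} (p : α → Prop) {l : List α} (h : ∃ x ∈ l, p x) :
    ∃ l₁ x l₂, l = l₁ ++ x :: l₂ ∧ p x ∧ ∀ y ∈ l₁, ¬ p y := by
  induction l with
  | nil => simp at h
  | cons a l ih =>
    by_cases ha : p a
    · exact ⟨[], a, l, rfl, ha, by simp⟩
    · obtain ⟨x, hx, hpx⟩ := h
      rcases List.mem_cons.1 hx with rfl | hx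
      · exact absurd hpx ha
      · obtain ⟨l₁, y, l₂, rfl, h₁, h₂⟩ := ih ⟨x, hx, hpx⟩
        exact ⟨a :: l₁, y, l₂, rfl, h₁, by simpa [ha] using h₂⟩

/-- If `v` stays below `a`, one splitting gathers the subtrees after this `a`. Otherwise a larger
letter of `v` is the root letter, and the prefix up to its first occurrence is treated by induction.
-/
theorem treeOfList_le_graft {u v : List ℕ} {a : ℕ} (hu : ∀ x ∈ u, x ≤ a) :
    PalaciosRoncoLE (treeOfList (u ++ a :: v)) (graft (subtrees a u ++ [treeOfList v])) := by
  induction h : v.length using Nat.strong_induction_on generalizing v with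
  | _ N ih =>
    subst h
    by_cases hv : ∀ x ∈ v, x ≤ a
    · rw [treeOfList_eq_graft (M := a), subtrees_append_cons, treeOfList_eq_graft hv]
      · exact .split (subtrees_ne_nil _ _) (subtrees_ne_nil _ _)
      · intro x hx
        simp only [List.mem_append, List.mem_cons] at hx
        rcases hx with hx | rfl | hx
        exacts [hu x hx, le_rfl, hv x hx]
    · have hne : v ≠ [] := by
        rintro rfl
        simp at hv
      obtain ⟨M, hM, hle⟩ := exists_max_mem hne
      have haM : a < M := by
        by_contra hc
        exact hv fun x hx => (hle x hx).trans (not_lt.1 hc)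
      obtain ⟨v₁, M', v₂, rfl, rfl, h₁⟩ := exists_first (· = M) ⟨M, hM, rfl⟩
      have h₁' : M' ∉ v₁ := fun h => h₁ _ h rfl
      have hn : M' ∉ u ++ a :: v₁ := by
        simp only [List.mem_append, List.mem_cons, not_or]
        exact ⟨fun h => absurd (hu _ h) (by omega), by omega, h₁'⟩
      rw [treeOfList_eq_graft hle, ← List.cons_append, ← List.append_assoc,
        treeOfList_eq_graft (M := M'), subtrees_append_cons, subtrees_append_cons,
        subtrees_of_notMem hn, subtrees_of_notMem h₁']
      -- Induction makes the leftmost child a graft of the subtrees of `u` and the tree of `v₁`;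
      -- contraction lifts these to the root, and splitting gathers the tree of `v₁` with the
      -- subtrees of `v₂`, which together form the tree of `v`.
      · refine (PalaciosRoncoLE.graft_child (ih v₁.length (by simp) rfl) [] _).trans ?_
        refine (PalaciosRoncoLE.contract (by simp) (subtrees_ne_nil _ _)).trans ?_
        rw [List.append_assoc]
        exact .split (subtrees_ne_nil _ _) (by simp)
      · intro x hx
        simp only [List.mem_append, List.mem_cons] at hx
        rcases hx with (hx | rfl | hx) | rfl | hx
        exacts [(hu x hx).trans haM.le, haM.le, hle x (by simp [hx]), le_rfl, hle x (by simp [hx])]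

/-- The separators occupy the same positions in both words, so the factors correspond one to one;
`ih` compares each pair of factors. -/
theorem forall₂_subtrees {M M' : ℕ} {z : List (ℕ × ℕ)} (hz : z.Pairwise InvLE)
    (hM : ∀ p ∈ z, p.1 = M ↔ p.2 = M')
    (ih : ∀ y : List (ℕ × ℕ), y.length ≤ z.length → y.Pairwise InvLE →
      PalaciosRoncoLE (treeOfList (y.map Prod.fst)) (treeOfList (y.map Prod.snd))) :
    List.Forall₂ PalaciosRoncoLE (subtrees M (z.map Prod.fst)) (subtrees M' (z.map Prod.snd)) := by
  induction h : z.length using Nat.strong_induction_on generalizing z with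
  | _ N ihN =>
    subst h
    by_cases h : ∃ p ∈ z, p.1 = M
    · obtain ⟨p, hp, hpM⟩ := h
      have hpM' := (hM p hp).1 hpM
      obtain ⟨a, b, rfl⟩ := List.append_of_mem hp
      rw [List.pairwise_append, List.pairwise_cons] at hz
      rw [List.map_append, List.map_append, List.map_cons, List.map_cons, hpM, hpM',
        subtrees_append_cons, subtrees_append_cons]
      refine List.rel_append ?_ ?_
      · refine ihN a.length (by simp) hz.1 (fun q hq => hM q (by simp [hq])) ?_ rfl
        exact fun y hy => ih y (by simp; omega)
      · refine ihN b.length (by simp; omega) hz.2.1.2 (fun q hq => hM q (by simp [hq])) ?_ rfl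
        exact fun y hy => ih y (by simp; omega)
    · have h₁ : M ∉ z.map Prod.fst := fun hm => by
        obtain ⟨p, hp, e⟩ := List.mem_map.1 hm
        exact h ⟨p, hp, e⟩
      have h₂ : M' ∉ z.map Prod.snd := fun hm => by
        obtain ⟨p, hp, e⟩ := List.mem_map.1 hm
        exact h ⟨p, hp, (hM p hp).2 e⟩
      rw [subtrees_of_notMem h₁, subtrees_of_notMem h₂]
      exact .cons (ih z le_rfl hz) .nil

theorem treeOfList_le_of_pairwise {z : List (ℕ × ℕ)} (hz : z.Pairwise InvLE) :
    PalaciosRoncoLE (treeOfList (z.map Prod.fst)) (treeOfList (z.map Prod.snd)) := by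
  induction h : z.length using Nat.strong_induction_on generalizing z with
  | _ N ih =>
    subst h
    by_cases hne : z = []
    · subst hne
      exact .refl _
    obtain ⟨zA, ⟨a, M⟩, zB, rfl, hA, hB⟩ := exists_last_max Prod.snd hne
    simp only at hA hB
    rw [List.pairwise_append, List.pairwise_cons] at hz
    obtain ⟨hzA, ⟨hsB, hzB⟩, hzAB⟩ := hz
    -- A lower letter above `a` would give a full inversion, hence an upper letter above `M`; a
    -- lower letter equal to `a` gives at least a half inversion, which forces the upper letter `M`.
    have hAa : ∀ p ∈ zA, p.1 ≤ a ∧ (p.1 = a → p.2 = M) := by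
      intro p hp
      have h₁ := hzAB p hp (a, M) (by simp)
      have h₂ := hA p hp
      have h₃ := h₁.1
      have h₄ := h₁.2
      simp only at h₃ h₄
      constructor
      · by_contra hc
        have := h₄ (by omega)
        omega
      · intro e
        have := h₃ e.ge
        omega
    rw [List.map_append, List.map_append, List.map_cons, List.map_cons]
    have hu : ∀ x ∈ zA.map Prod.fst, x ≤ a := by
      intro x hx
      obtain ⟨p, hp, rfl⟩ := List.mem_map.1 hx
      exact (hAa p hp).1
    refine (treeOfList_le_graft hu).trans ?_
    have hB' : M ∉ zB.map Prod.snd := by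
      intro hm
      obtain ⟨p, hp, e⟩ := List.mem_map.1 hm
      exact absurd (hB p hp) (by omega)
    rw [treeOfList_eq_graft (M := M) (w := zA.map Prod.snd ++ M :: zB.map Prod.snd),
      subtrees_append_cons, subtrees_of_notMem hB']
    swap
    · intro x hx
      simp only [List.mem_append, List.mem_cons, List.mem_map] at hx
      rcases hx with ⟨p, hp, rfl⟩ | rfl | ⟨p, hp, rfl⟩
      exacts [hA p hp, le_rfl, (hB p hp).le]
    have ihB := ih zB.length (by simp; omega) hzB rfl
    by_cases hex : ∃ p ∈ zA, p.1 = a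
    -- After the first `a`, the letters `a` and `M` occur at the same positions: a smaller lower
    -- letter is fully inverted with `q`, so its upper letter is below `M`. Before it, `M` may occur
    -- in the upper word although `a` is absent below; the final contraction accounts for this.
    · obtain ⟨z₁, q, z₂, rfl, hqa, hz₁⟩ := exists_first (fun p : ℕ × ℕ => p.1 = a) hex
      have hqM : q.2 = M := (hAa q (by simp)).2 hqa
      have hn : a ∉ z₁.map Prod.fst := by
        intro hm
        obtain ⟨p, hp, e⟩ := List.mem_map.1 hm
        exact hz₁ p hp e
      rw [List.pairwise_append, List.pairwise_cons] at hzA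
      obtain ⟨hz₁', ⟨hqz₂, hz₂⟩, -⟩ := hzA
      have hl : ((z₁ ++ q :: z₂) ++ (a, M) :: zB).length = z₁.length + z₂.length + zB.length + 2 := by
        simp only [List.length_append, List.length_cons]
        omega
      have h₂ : List.Forall₂ PalaciosRoncoLE (subtrees a (z₂.map Prod.fst))
          (subtrees M (z₂.map Prod.snd)) := by
        refine forall₂_subtrees hz₂ (fun p hp => ⟨(hAa p (by simp [hp])).2, fun e => ?_⟩)
          fun y hy hy' => ih y.length (by omega) hy' rfl
        have h₃ := (hqz₂ p hp).2
        have h₄ := (hAa p (by simp [hp])).1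
        by_contra hc
        have := h₃ (by omega)
        omega
      rw [List.map_append, List.map_append, List.map_cons, List.map_cons, hqa, hqM,
        subtrees_append_cons, subtrees_append_cons, subtrees_of_notMem hn]
      have hc : List.Forall₂ PalaciosRoncoLE
          ([treeOfList (z₁.map Prod.fst)] ++ subtrees a (z₂.map Prod.fst) ++
            [treeOfList (zB.map Prod.fst)])
          ([treeOfList (z₁.map Prod.snd)] ++ subtrees M (z₂.map Prod.snd) ++
            [treeOfList (zB.map Prod.snd)]) :=
        List.rel_append (List.rel_append
          (.cons (ih z₁.length (by omega) hz₁' rfl) .nil) h₂) (.cons ihB .nil)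
      refine (PalaciosRoncoLE.graft_congr hc).trans ?_
      rw [treeOfList_eq_graft (M := M) (w := z₁.map Prod.snd), List.append_assoc,
        List.append_assoc]
      · exact .contract (subtrees_ne_nil _ _) (by simp)
      · intro x hx
        obtain ⟨p, hp, rfl⟩ := List.mem_map.1 hx
        exact hA p (by simp [hp])
    · have hn : a ∉ zA.map Prod.fst := by
        intro hm
        obtain ⟨p, hp, e⟩ := List.mem_map.1 hm
        exact hex ⟨p, hp, e⟩
      rw [subtrees_of_notMem hn]
      have hc : List.Forall₂ PalaciosRoncoLE
          ([treeOfList (zA.map Prod.fst)] ++ [treeOfList (zB.map Prod.fst)])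
          ([treeOfList (zA.map Prod.snd)] ++ [treeOfList (zB.map Prod.snd)]) :=
        .cons (ih zA.length (by simp) hzA rfl) (.cons ihB .nil)
      refine (PalaciosRoncoLE.graft_congr hc).trans ?_
      rw [treeOfList_eq_graft (M := M) (w := zA.map Prod.snd)]
      · exact .contract (subtrees_ne_nil _ _) (by simp)
      · intro x hx
        obtain ⟨p, hp, rfl⟩ := List.mem_map.1 hx
        exact hA p hp


/-! ### Words obtained by joining words with a separator -/

section Intercalate

variable {α β : Type*}

theorem intercalate_singleton_cons (s : α) (x : List α) {xs : List (List α)} (h : xs ≠ []) :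
    [s].intercalate (x :: xs) = x ++ s :: [s].intercalate xs := by
  rw [List.intercalate_cons_of_ne_nil h]
  simp

theorem mem_intercalate {s x : α} {xs : List (List α)} (h : x ∈ [s].intercalate xs) :
    x = s ∨ ∃ l ∈ xs, x ∈ l := by
  induction xs with
  | nil => simp at h
  | cons a xs ih =>
    by_cases hxs : xs = []
    · subst hxs
      rw [List.intercalate_singleton] at h
      exact .inr ⟨a, by simp, h⟩
    · rw [intercalate_singleton_cons s a hxs, List.mem_append, List.mem_cons] at h
      rcases h with h | h | h
      · exact .inr ⟨a, by simp, h⟩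
      · exact .inl h
      · rcases ih h with h | ⟨l, hl, h⟩
        · exact .inl h
        · exact .inr ⟨l, by simp [hl], h⟩

theorem map_intercalate (f : α → β) (s : α) (xs : List (List α)) :
    ([s].intercalate xs).map f = [f s].intercalate (xs.map (List.map f)) := by
  induction xs with
  | nil => simp
  | cons a xs ih =>
    by_cases hxs : xs = []
    · subst hxs
      simp [List.intercalate_singleton]
    · rw [intercalate_singleton_cons s a hxs, List.map_append, List.map_cons, ih, List.map_cons,
        intercalate_singleton_cons _ _ (by simpa using hxs)]

theorem intercalate_append (s : α) {xs ys : List (List α)} (hx : xs ≠ []) (hy : ys ≠ []) :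
    [s].intercalate (xs ++ ys) = [s].intercalate xs ++ s :: [s].intercalate ys := by
  induction xs with
  | nil => exact absurd rfl hx
  | cons a xs ih =>
    by_cases hxs : xs = []
    · subst hxs
      rw [List.singleton_append, intercalate_singleton_cons s a hy, List.intercalate_singleton]
    · rw [List.cons_append, intercalate_singleton_cons s a (by simp [hxs]), ih hxs,
        intercalate_singleton_cons s a hxs]
      simp

theorem pairwise_intercalate {R : α → α → Prop} {s : α} {xs : List (List α)}
    (h : ∀ l ∈ xs, l.Pairwise R) (hc : xs.Pairwise fun a b => ∀ p ∈ a, ∀ q ∈ b, R p q)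
    (hs : ∀ l ∈ xs, ∀ p ∈ l, R p s ∧ R s p) (hss : R s s) : ([s].intercalate xs).Pairwise R := by
  induction xs with
  | nil => simp
  | cons a xs ih =>
    by_cases hxs : xs = []
    · subst hxs
      rw [List.intercalate_singleton]
      exact h a (by simp)
    · rw [List.pairwise_cons] at hc
      rw [intercalate_singleton_cons s a hxs, List.pairwise_append, List.pairwise_cons]
      refine ⟨h a (by simp), ⟨fun q hq => ?_, ih (fun l hl => h l (by simp [hl])) hc.2
        fun l hl => hs l (by simp [hl])⟩, fun p hp q hq => ?_⟩
      · rcases mem_intercalate hq with rfl | ⟨l, hl, hq⟩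
        · exact hss
        · exact (hs l (by simp [hl]) q hq).2
      · have hps := (hs a (by simp) p hp).1
        rcases List.mem_cons.1 hq with rfl | hq
        · exact hps
        · rcases mem_intercalate hq with rfl | ⟨l, hl, hq⟩
          · exact hps
          · exact hc.1 l hl p hp q hq

end Intercalate

theorem treeOfList_intercalate {M : ℕ} {us : List (List ℕ)} (hne : us ≠ [])
    (h : ∀ u ∈ us, ∀ x ∈ u, x < M) :
    treeOfList ([M].intercalate us) = graft (us.map treeOfList) := by
  rw [treeOfList_eq_graft (M := M), subtrees, List.splitOn_intercalate _ _ hne]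
  · exact fun l hl hM => absurd (h l hl M hM) (lt_irrefl _)
  · intro x hx
    rcases mem_intercalate hx with rfl | ⟨l, hl, hx⟩
    exacts [le_rfl, (h l hl x hx).le]

/-! ### Canonical words -/

/-- `w` is above every word with the same plane tree. -/
def IsMaxWord (w : List ℕ) : Prop :=
  ∀ w', treeOfList w' = treeOfList w →
    ∃ z : List (ℕ × ℕ), z.map Prod.fst = w' ∧ z.map Prod.snd = w ∧ z.Pairwise InvLE

theorem isMaxWord_nil : IsMaxWord [] := by
  intro w' h
  have := congrArg leaves h
  rw [leaves_treeOfList, leaves_treeOfList] at this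
  obtain rfl : w' = [] := List.length_eq_zero_iff.1 (by simpa using this)
  exact ⟨[], rfl, rfl, .nil⟩

theorem strictMono_add_right (c : ℕ) : StrictMono (· + c) := fun _ _ h => Nat.add_lt_add_right h c

theorem treeOfList_map_add (c : ℕ) (w : List ℕ) : treeOfList (w.map (· + c)) = treeOfList w :=
  treeOfList_map ((strictMono_add_right c).strictMonoOn _)

theorem IsMaxWord.map_add {w : List ℕ} (hw : IsMaxWord w) (c : ℕ) :
    IsMaxWord (w.map (· + c)) := by
  intro w' h
  rw [treeOfList_map_add] at h
  obtain ⟨z, rfl, rfl, hz⟩ := hw w' h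
  refine ⟨z.map fun p => (p.1, p.2 + c), by simp, by simp, List.pairwise_map.2 (hz.imp ?_)⟩
  intro p q h
  simpa [InvLE] using h

theorem exists_lists_of_forall₂ {us us' : List (List ℕ)}
    (h : List.Forall₂ (fun u' u => ∃ z : List (ℕ × ℕ), z.map Prod.fst = u' ∧ z.map Prod.snd = u ∧
      z.Pairwise InvLE) us' us) :
    ∃ zs : List (List (ℕ × ℕ)), zs.map (List.map Prod.fst) = us' ∧
      zs.map (List.map Prod.snd) = us ∧ ∀ z ∈ zs, z.Pairwise InvLE := by
  induction h with
  | nil => exact ⟨[], rfl, rfl, by simp⟩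
  | cons h _ ih =>
    obtain ⟨z, rfl, rfl, hz⟩ := h
    obtain ⟨zs, rfl, rfl, hzs⟩ := ih
    exact ⟨z :: zs, rfl, rfl, by simpa [hz] using hzs⟩

/-- A word with the same tree splits at its greatest letter into factors with the same subtrees.
Each factor is dominated by hypothesis; separators compare alike in both words; letters of distinct
factors are fully inverted in the upper word, the largest possible value. -/
theorem IsMaxWord.intercalate {M : ℕ} {us : List (List ℕ)} (h2 : 2 ≤ us.length)
    (h : ∀ u ∈ us, IsMaxWord u ∧ ∀ x ∈ u, x < M)
    (hc : us.Pairwise fun u v => ∀ x ∈ u, ∀ y ∈ v, y < x) : IsMaxWord ([M].intercalate us) := by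
  intro w' hw'
  have hne : us ≠ [] := by
    rintro rfl
    simp at h2
  rw [treeOfList_intercalate hne fun u hu => (h u hu).2] at hw'
  have hw : w' ≠ [] := by
    rintro rfl
    rw [treeOfList_nil] at hw'
    exact graft_ne_leaf (by simpa using h2) hw'.symm
  obtain ⟨M', hM', hle⟩ := exists_max_mem hw
  rw [treeOfList_eq_graft hle] at hw'
  have e := graft_injective (two_le_length_subtrees hM') (by simpa using h2) hw'
  have hf : List.Forall₂ (fun u' u => ∃ z : List (ℕ × ℕ), z.map Prod.fst = u' ∧
      z.map Prod.snd = u ∧ z.Pairwise InvLE) (w'.splitOn M') us := by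
    rw [subtrees, ← List.forall₂_eq_eq_eq, List.forall₂_map_left_iff,
      List.forall₂_map_right_iff] at e
    have h' : ∀ u ∈ us, IsMaxWord u := fun u hu => (h u hu).1
    clear * - e h'
    generalize w'.splitOn M' = us' at e
    induction e with
    | nil => exact .nil
    | cons hd _ ih =>
      exact .cons (h' _ (by simp) _ hd) (ih fun u hu => h' u (by simp [hu]))
  obtain ⟨zs, h₁, rfl, hzs⟩ := exists_lists_of_forall₂ hf
  have hlt : ∀ z ∈ zs, ∀ p ∈ z, p.1 < M' ∧ p.2 < M := by
    intro z hz p hp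
    constructor
    · have hm : z.map Prod.fst ∈ w'.splitOn M' := h₁ ▸ List.mem_map_of_mem hz
      have := mem_of_mem_splitOn hm (List.mem_map_of_mem hp)
      exact lt_of_le_of_ne (hle _ this.1) this.2
    · exact (h _ (List.mem_map_of_mem hz)).2 _ (List.mem_map_of_mem hp)
  refine ⟨[(M', M)].intercalate zs, ?_, ?_, pairwise_intercalate hzs ?_ ?_ ?_⟩
  · rw [map_intercalate, h₁, List.intercalate_splitOn]
  · rw [map_intercalate]
  · refine (List.pairwise_map.1 hc).imp fun {a b} hab p hp q hq => ?_
    have := hab _ (List.mem_map_of_mem hp) _ (List.mem_map_of_mem hq)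
    exact ⟨fun _ => this.le, fun _ => this⟩
  · intro z hz p hp
    have := hlt z hz p hp
    constructor <;> simp only [InvLE] <;> omega
  · simp [InvLE]

/-! ### Realizing the moves by comparable words -/

/-- There are comparable words with trees `t` and `t'`, the smaller of which is canonical. -/
def Realizable (t t' : PlaneTree) : Prop :=
  ∃ z : List (ℕ × ℕ), z.Pairwise InvLE ∧ IsMaxWord (z.map Prod.fst) ∧
    treeOfList (z.map Prod.fst) = t ∧ treeOfList (z.map Prod.snd) = t'

/-- A list of pairs of comparable words with letters less than `M`, the letters of each word
being greater than those of the subsequent ones. -/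
structure IsForest (zs : List (List (ℕ × ℕ))) (M : ℕ) : Prop where
  pairwise : ∀ z ∈ zs, z.Pairwise InvLE
  isMaxWord : ∀ z ∈ zs, IsMaxWord (z.map Prod.fst)
  lt : ∀ z ∈ zs, ∀ p ∈ z, p.1 < M ∧ p.2 < M
  cross : zs.Pairwise fun a b => ∀ p ∈ a, ∀ q ∈ b, q.1 < p.1 ∧ q.2 < p.2

theorem exists_bound (z : List (ℕ × ℕ)) : ∃ M, ∀ p ∈ z, p.1 < M ∧ p.2 < M := by
  induction z with
  | nil => exact ⟨0, by simp⟩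
  | cons a z ih =>
    obtain ⟨M, hM⟩ := ih
    refine ⟨M + a.1 + a.2 + 1, fun p hp => ?_⟩
    rcases List.mem_cons.1 hp with rfl | hp
    · omega
    · have := hM p hp
      omega

theorem exists_isForest {ts ts' : List PlaneTree} (h : List.Forall₂ Realizable ts ts') :
    ∃ zs M, IsForest zs M ∧ zs.map (fun z => treeOfList (z.map Prod.fst)) = ts ∧
      zs.map (fun z => treeOfList (z.map Prod.snd)) = ts' := by
  induction h with
  | nil => exact ⟨[], 0, ⟨by simp, by simp, by simp, .nil⟩, rfl, rfl⟩
  | cons h _ ih =>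
    obtain ⟨zs, M, hF, rfl, rfl⟩ := ih
    obtain ⟨z, hz, hmax, rfl, rfl⟩ := h
    obtain ⟨K, hK⟩ := exists_bound z
    have e₁ : (z.map fun p => (p.1 + M, p.2 + M)).map Prod.fst = (z.map Prod.fst).map (· + M) := by
      simp
    have e₂ : (z.map fun p => (p.1 + M, p.2 + M)).map Prod.snd = (z.map Prod.snd).map (· + M) := by
      simp
    -- Shifting the new first pair of words by `M` puts its letters above all letters of the later
    -- ones.
    refine ⟨(z.map fun p => (p.1 + M, p.2 + M)) :: zs, M + K, ⟨?_, ?_, ?_, ?_⟩, ?_, ?_⟩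
    · intro y hy
      rcases List.mem_cons.1 hy with rfl | hy
      · refine List.pairwise_map.2 (hz.imp ?_)
        intro p q h
        simpa [InvLE] using h
      · exact hF.pairwise y hy
    · intro y hy
      rcases List.mem_cons.1 hy with rfl | hy
      · rw [e₁]
        exact hmax.map_add M
      · exact hF.isMaxWord y hy
    · intro y hy p hp
      rcases List.mem_cons.1 hy with rfl | hy
      · obtain ⟨q, hq, rfl⟩ := List.mem_map.1 hp
        have := hK q hq
        simp only
        omega
      · have := hF.lt y hy p hp
        omega
    · refine List.pairwise_cons.2 ⟨fun y hy p hp q hq => ?_, hF.cross⟩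
      obtain ⟨p, -, rfl⟩ := List.mem_map.1 hp
      have := hF.lt y hy q hq
      simp only
      omega
    · rw [List.map_cons, e₁, treeOfList_map_add]
    · rw [List.map_cons, e₂, treeOfList_map_add]

namespace IsForest

variable {zs xs ys : List (List (ℕ × ℕ))} {M : ℕ}

theorem invLE_cross (h : IsForest zs M) :
    zs.Pairwise fun a b => ∀ p ∈ a, ∀ q ∈ b, InvLE p q :=
  h.cross.imp fun hab p hp q hq => ⟨fun _ => (hab p hp q hq).2.le, fun _ => (hab p hp q hq).2⟩

theorem isMaxWord_intercalate (h : IsForest zs M) (h2 : 2 ≤ zs.length) {N : ℕ} (hN : M ≤ N) :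
    IsMaxWord ([N].intercalate (zs.map (List.map Prod.fst))) := by
  refine IsMaxWord.intercalate (by simpa using h2) ?_
    (List.pairwise_map.2 (h.cross.imp fun hab => ?_))
  · intro u hu
    obtain ⟨z, hz, rfl⟩ := List.mem_map.1 hu
    refine ⟨h.isMaxWord z hz, fun x hx => ?_⟩
    obtain ⟨p, hp, rfl⟩ := List.mem_map.1 hx
    exact (h.lt z hz p hp).1.trans_le hN
  · intro x hx y hy
    obtain ⟨p, hp, rfl⟩ := List.mem_map.1 hx
    obtain ⟨q, hq, rfl⟩ := List.mem_map.1 hy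
    exact (hab p hp q hq).1

theorem treeOfList_fst (h : IsForest zs M) (hne : zs ≠ []) {N : ℕ} (hN : M ≤ N) :
    treeOfList ([N].intercalate (zs.map (List.map Prod.fst))) =
      graft (zs.map fun z => treeOfList (z.map Prod.fst)) := by
  rw [treeOfList_intercalate (by simpa using hne), List.map_map]
  · rfl
  · intro u hu x hx
    obtain ⟨z, hz, rfl⟩ := List.mem_map.1 hu
    obtain ⟨p, hp, rfl⟩ := List.mem_map.1 hx
    exact (h.lt z hz p hp).1.trans_le hN

theorem treeOfList_snd (h : IsForest zs M) (hne : zs ≠ []) {N : ℕ} (hN : M ≤ N) :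
    treeOfList ([N].intercalate (zs.map (List.map Prod.snd))) =
      graft (zs.map fun z => treeOfList (z.map Prod.snd)) := by
  rw [treeOfList_intercalate (by simpa using hne), List.map_map]
  · rfl
  · intro u hu x hx
    obtain ⟨z, hz, rfl⟩ := List.mem_map.1 hu
    obtain ⟨p, hp, rfl⟩ := List.mem_map.1 hx
    exact (h.lt z hz p hp).2.trans_le hN

theorem pairwise_intercalate (h : IsForest zs M) {s : ℕ × ℕ} (h₁ : M ≤ s.1) (h₂ : M ≤ s.2) :
    ([s].intercalate zs).Pairwise InvLE := by
  refine PackedTrees.pairwise_intercalate h.pairwise h.invLE_cross (fun z hz p hp => ?_)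
    (by simp [InvLE])
  have := h.lt z hz p hp
  constructor <;> simp only [InvLE] <;> omega

theorem append_left (h : IsForest (xs ++ ys) M) : IsForest xs M where
  pairwise z hz := h.pairwise z (by simp [hz])
  isMaxWord z hz := h.isMaxWord z (by simp [hz])
  lt z hz := h.lt z (by simp [hz])
  cross := (List.pairwise_append.1 h.cross).1

theorem append_right (h : IsForest (xs ++ ys) M) : IsForest ys M where
  pairwise z hz := h.pairwise z (by simp [hz])
  isMaxWord z hz := h.isMaxWord z (by simp [hz])
  lt z hz := h.lt z (by simp [hz])
  cross := (List.pairwise_append.1 h.cross).2.1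

end IsForest

namespace Realizable

theorem graft_congr {ts ts' : List PlaneTree} (h2 : 2 ≤ ts.length)
    (h : List.Forall₂ Realizable ts ts') : Realizable (graft ts) (graft ts') := by
  obtain ⟨zs, M, hF, rfl, rfl⟩ := exists_isForest h
  rw [List.length_map] at h2
  have hne : zs ≠ [] := by
    rintro rfl
    simp at h2
  refine ⟨[(M, M)].intercalate zs, hF.pairwise_intercalate le_rfl le_rfl, ?_, ?_, ?_⟩
  · rw [map_intercalate]
    exact hF.isMaxWord_intercalate h2 le_rfl
  · rw [map_intercalate, hF.treeOfList_fst hne le_rfl]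
  · rw [map_intercalate, hF.treeOfList_snd hne le_rfl]

/-- This contains the existence of canonical words: the lower word of the pair is above every word
with tree `t`. -/
theorem refl (t : PlaneTree) : Realizable t t := by
  induction h : t.leaves using Nat.strong_induction_on generalizing t with
  | _ N ih =>
    subst h
    obtain _ | ⟨l, m, r⟩ := t
    · exact ⟨[], .nil, isMaxWord_nil, by simp, by simp⟩
    · rw [← graft_cons_append]
      refine graft_congr (by simp) (List.forall₂_same.2 fun t ht => ih _ ?_ t rfl)
      have hl := l.leaves_pos
      have hr := r.leaves_pos
      rw [leaves]
      simp only [List.mem_cons, List.mem_append, List.not_mem_nil, or_false] at ht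
      rcases ht with rfl | ht | rfl
      · omega
      · have := List.single_le_sum (l := m.map leaves) (by simp) _ (List.mem_map_of_mem ht)
        omega
      · omega

theorem graft_child {t t' : PlaneTree} (h : Realizable t t') {xs ys : List PlaneTree}
    (h2 : 1 ≤ xs.length + ys.length) :
    Realizable (graft (xs ++ t :: ys)) (graft (xs ++ t' :: ys)) :=
  graft_congr (by simp; omega) (List.rel_append (List.forall₂_same.2 fun t _ => refl t)
    (.cons h (List.forall₂_same.2 fun t _ => refl t)))

theorem contract {xs ys : List PlaneTree} (hx : 2 ≤ xs.length) (hy : ys ≠ []) :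
    Realizable (graft (graft xs :: ys)) (graft (xs ++ ys)) := by
  obtain ⟨zs, M, hF, e₁, e₂⟩ := exists_isForest
    (List.forall₂_same.2 fun t (_ : t ∈ xs ++ ys) => refl t)
  obtain ⟨z₁, z₂, rfl, rfl, rfl⟩ := List.map_eq_append_iff.1 e₁
  rw [List.map_append] at e₂
  have hF₁ := hF.append_left
  have hF₂ := hF.append_right
  rw [List.length_map] at hx
  have hne₁ : z₁ ≠ [] := by
    rintro rfl
    simp at hx
  have hne₂ : z₂ ≠ [] := by
    rintro rfl
    simp at hy
  have hM := Nat.le_succ M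
  have hcross := (List.pairwise_append.1 hF.cross).2.2
  -- In the lower word the separators `M` of the first group lie below the root letter `M + 1`,
  -- which creates the leftmost child; raising them to `M + 1` in a prefix can only increase
  -- inversions.
  refine ⟨[(M, M + 1)].intercalate z₁ ++ (M + 1, M + 1) :: [(M + 1, M + 1)].intercalate z₂,
    ?_, ?_, ?_, ?_⟩
  · have hb : ∀ q ∈ [(M + 1, M + 1)].intercalate z₂, q.1 ≤ M + 1 ∧ q.2 ≤ M + 1 := by
      intro q hq
      rcases mem_intercalate hq with rfl | ⟨z, hz, hq⟩
      · simp
      · have := hF₂.lt z hz q hq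
        omega
    refine List.pairwise_append.2 ⟨hF₁.pairwise_intercalate le_rfl hM,
      List.pairwise_cons.2 ⟨fun q hq => ?_, hF₂.pairwise_intercalate hM hM⟩, fun p hp q hq => ?_⟩
    · rcases mem_intercalate hq with rfl | ⟨z, hz, hq⟩
      · simp [InvLE]
      · have := hF₂.lt z hz q hq
        simp only [InvLE]
        omega
    · rcases mem_intercalate hp with rfl | ⟨y, hy, hp⟩
      · rcases List.mem_cons.1 hq with rfl | hq
        · simp [InvLE]
        · rcases mem_intercalate hq with rfl | ⟨z, hz, hq⟩
          · simp [InvLE]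
          · have := hF₂.lt z hz q hq
            simp only [InvLE]
            omega
      · have hp' := hF₁.lt y hy p hp
        rcases List.mem_cons.1 hq with rfl | hq
        · simp only [InvLE]
          omega
        · rcases mem_intercalate hq with rfl | ⟨z, hz, hq⟩
          · simp only [InvLE]
            omega
          · have := hcross y hy z hz p hp q hq
            simp only [InvLE]
            omega
  all_goals rw [List.map_append, List.map_cons, map_intercalate, map_intercalate]
  · have hmax := hF₁.isMaxWord_intercalate hx le_rfl
    rw [← intercalate_singleton_cons _ _ (by simpa using hne₂)]
    refine IsMaxWord.intercalate ?_ ?_ ?_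
    · have := List.length_pos_of_ne_nil hne₂
      simp
      omega
    · intro u hu
      rcases List.mem_cons.1 hu with rfl | hu
      · refine ⟨hmax, fun x hx => ?_⟩
        rcases mem_intercalate hx with rfl | ⟨l, hl, hx⟩
        · exact Nat.lt_succ_self _
        · obtain ⟨z, hz, rfl⟩ := List.mem_map.1 hl
          obtain ⟨p, hp, rfl⟩ := List.mem_map.1 hx
          exact (hF₁.lt z hz p hp).1.trans_le hM
      · obtain ⟨z, hz, rfl⟩ := List.mem_map.1 hu
        refine ⟨hF₂.isMaxWord z hz, fun x hx => ?_⟩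
        obtain ⟨p, hp, rfl⟩ := List.mem_map.1 hx
        exact (hF₂.lt z hz p hp).1.trans_le hM
    · refine List.pairwise_cons.2 ⟨?_, List.pairwise_map.2 (hF₂.cross.imp fun hab => ?_)⟩
      · intro u hu x hx y hy
        obtain ⟨z, hz, rfl⟩ := List.mem_map.1 hu
        obtain ⟨q, hq, rfl⟩ := List.mem_map.1 hy
        rcases mem_intercalate hx with rfl | ⟨l, hl, hx⟩
        · exact (hF₂.lt z hz q hq).1
        · obtain ⟨y, hy, rfl⟩ := List.mem_map.1 hl
          obtain ⟨p, hp, rfl⟩ := List.mem_map.1 hx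
          exact (hcross y hy z hz p hp q hq).1
      · intro x hx y hy
        obtain ⟨p, hp, rfl⟩ := List.mem_map.1 hx
        obtain ⟨q, hq, rfl⟩ := List.mem_map.1 hy
        exact (hab p hp q hq).1
  · have hlt : M + 1 ∉ [M].intercalate (z₁.map (List.map Prod.fst)) := by
      intro hm
      rcases mem_intercalate hm with h | ⟨l, hl, hx⟩
      · omega
      · obtain ⟨z, hz, rfl⟩ := List.mem_map.1 hl
        obtain ⟨p, hp, e⟩ := List.mem_map.1 hx
        have := (hF₁.lt z hz p hp).1
        omega
    rw [← hF₁.treeOfList_fst hne₁ le_rfl, treeOfList_eq_graft (M := M + 1), subtrees_append_cons,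
      subtrees_of_notMem hlt, subtrees, List.splitOn_intercalate, List.map_map]
    · rfl
    · intro l hl hm
      obtain ⟨z, hz, rfl⟩ := List.mem_map.1 hl
      obtain ⟨p, hp, e⟩ := List.mem_map.1 hm
      have := (hF₂.lt z hz p hp).1
      omega
    · simpa using hne₂
    · intro x hx
      rcases List.mem_append.1 hx with hx | hx
      · rcases mem_intercalate hx with rfl | ⟨l, hl, hx⟩
        · exact hM
        · obtain ⟨z, hz, rfl⟩ := List.mem_map.1 hl
          obtain ⟨p, hp, rfl⟩ := List.mem_map.1 hx
          exact (hF₁.lt z hz p hp).1.le.trans hM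
      · rcases List.mem_cons.1 hx with rfl | hx
        · exact le_rfl
        · rcases mem_intercalate hx with rfl | ⟨l, hl, hx⟩
          · exact le_rfl
          · obtain ⟨z, hz, rfl⟩ := List.mem_map.1 hl
            obtain ⟨p, hp, rfl⟩ := List.mem_map.1 hx
            exact (hF₂.lt z hz p hp).1.le.trans hM
  · rw [← intercalate_append _ (by simpa using hne₁) (by simpa using hne₂), ← List.map_append,
      hF.treeOfList_snd (by simp [hne₁]) hM, List.map_append, e₂]

theorem split {xs ys : List PlaneTree} (hx : xs ≠ []) (hy : 2 ≤ ys.length) :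
    Realizable (graft (xs ++ ys)) (graft (xs ++ [graft ys])) := by
  obtain ⟨zs, M, hF, e₁, e₂⟩ := exists_isForest
    (List.forall₂_same.2 fun t (_ : t ∈ xs ++ ys) => refl t)
  obtain ⟨z₁, z₂, rfl, e₃, e₄⟩ := List.map_eq_append_iff.1 e₂
  have hF₁ := hF.append_left
  have hF₂ := hF.append_right
  have hne₁ : z₁ ≠ [] := by
    rintro rfl
    exact hx e₃.symm
  have hy' : 2 ≤ z₂.length := by rw [← e₄, List.length_map] at hy; exact hy
  have hne₂ : z₂ ≠ [] := by
    rintro rfl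
    simp at hy'
  have hM := Nat.le_succ M
  have hcross := (List.pairwise_append.1 hF.cross).2.2
  -- The lower word has the single separator `M + 1`; lowering it to `M` in the suffix increases
  -- inversions with earlier positions and creates the rightmost child.
  refine ⟨[(M + 1, M + 1)].intercalate z₁ ++ (M + 1, M + 1) :: [(M + 1, M)].intercalate z₂,
    ?_, ?_, ?_, ?_⟩
  · refine List.pairwise_append.2 ⟨hF₁.pairwise_intercalate hM hM,
      List.pairwise_cons.2 ⟨fun q hq => ?_, hF₂.pairwise_intercalate hM le_rfl⟩,
      fun p hp q hq => ?_⟩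
    · rcases mem_intercalate hq with rfl | ⟨z, hz, hq⟩
      · simp [InvLE]
      · have := hF₂.lt z hz q hq
        simp only [InvLE]
        omega
    · rcases mem_intercalate hp with rfl | ⟨y, hy, hp⟩
      · rcases List.mem_cons.1 hq with rfl | hq
        · simp [InvLE]
        · rcases mem_intercalate hq with rfl | ⟨z, hz, hq⟩
          · simp [InvLE]
          · have := hF₂.lt z hz q hq
            simp only [InvLE]
            omega
      · have hp' := hF₁.lt y hy p hp
        rcases List.mem_cons.1 hq with rfl | hq
        · simp only [InvLE]
          omega
        · rcases mem_intercalate hq with rfl | ⟨z, hz, hq⟩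
          · simp only [InvLE]
            omega
          · have := hcross y hy z hz p hp q hq
            simp only [InvLE]
            omega
  all_goals rw [List.map_append, List.map_cons, map_intercalate, map_intercalate]
  · rw [← intercalate_append _ (by simpa using hne₁) (by simpa using hne₂), ← List.map_append]
    exact hF.isMaxWord_intercalate (by simp; omega) hM
  · rw [← intercalate_append _ (by simpa using hne₁) (by simpa using hne₂), ← List.map_append,
      hF.treeOfList_fst (by simp [hne₁]) hM, e₁]
  · have hlt : M + 1 ∉ [M].intercalate (z₂.map (List.map Prod.snd)) := by
      intro hm
      rcases mem_intercalate hm with h | ⟨l, hl, hx⟩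
      · omega
      · obtain ⟨z, hz, rfl⟩ := List.mem_map.1 hl
        obtain ⟨p, hp, e⟩ := List.mem_map.1 hx
        have := (hF₂.lt z hz p hp).2
        omega
    rw [← e₄, ← hF₂.treeOfList_snd hne₂ le_rfl, treeOfList_eq_graft (M := M + 1),
      subtrees_append_cons, subtrees_of_notMem hlt, subtrees, List.splitOn_intercalate,
      List.map_map, ← e₃]
    · rfl
    · intro l hl hm
      obtain ⟨z, hz, rfl⟩ := List.mem_map.1 hl
      obtain ⟨p, hp, e⟩ := List.mem_map.1 hm
      have := (hF₁.lt z hz p hp).2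
      omega
    · simpa using hne₁
    · intro x hx
      rcases List.mem_append.1 hx with hx | hx
      · rcases mem_intercalate hx with rfl | ⟨l, hl, hx⟩
        · exact le_rfl
        · obtain ⟨z, hz, rfl⟩ := List.mem_map.1 hl
          obtain ⟨p, hp, rfl⟩ := List.mem_map.1 hx
          exact (hF₁.lt z hz p hp).2.le.trans hM
      · rcases List.mem_cons.1 hx with rfl | hx
        · exact le_rfl
        · rcases mem_intercalate hx with rfl | ⟨l, hl, hx⟩
          · exact hM
          · obtain ⟨z, hz, rfl⟩ := List.mem_map.1 hl
            obtain ⟨p, hp, rfl⟩ := List.mem_map.1 hx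
            exact (hF₂.lt z hz p hp).2.le.trans hM

theorem of_move {t t' : PlaneTree} (h : Move t t') : Realizable t t' := by
  induction h with
  | contractLeft a m b m' r =>
    have := contract (xs := a :: (m ++ [b])) (ys := m' ++ [r]) (by simp) (by simp)
    have e : a :: (m ++ [b]) ++ (m' ++ [r]) = a :: ((m ++ b :: m') ++ [r]) := by simp
    rwa [e, graft_cons_append, graft_cons_append, graft_cons_append] at this
  | splitRight l m a m' b =>
    have := split (xs := l :: m) (ys := a :: (m' ++ [b])) (by simp) (by simp)
    have e : l :: m ++ a :: (m' ++ [b]) = l :: ((m ++ a :: m') ++ [b]) := by simp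
    rwa [e, List.cons_append, graft_cons_append, graft_cons_append, graft_cons_append] at this
  | inLeft m r _ ih =>
    rw [← graft_cons_append, ← graft_cons_append]
    exact graft_child ih (xs := []) (by simp)
  | inMiddle l m m' r _ ih =>
    have := graft_child ih (xs := l :: m) (ys := m' ++ [r]) (by simp; omega)
    simpa only [← graft_cons_append, List.append_assoc, List.cons_append] using this
  | inRight l m _ ih =>
    rw [← graft_cons_append, ← graft_cons_append]
    exact graft_child ih (xs := l :: m) (ys := []) (by simp)

end Realizable


/-! ### Joins of total preorders -/

section Crossing

open Relation

variable {α : Type*} {P₀ P₁ : α → α → Prop}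

/-- Pairs connected by a path of `P₀`-steps and one `P₁`-step. -/
def ViaStep (P₀ P₁ : α → α → Prop) (i j : α) : Prop :=
  ∃ x y, ReflTransGen P₀ i x ∧ P₁ x y ∧ ReflTransGen P₀ y j

theorem ViaStep.head {i j k : α} (h : ReflTransGen P₀ i j) (h' : ViaStep P₀ P₁ j k) :
    ViaStep P₀ P₁ i k := by
  obtain ⟨x, y, h₁, h₂, h₃⟩ := h'
  exact ⟨x, y, h.trans h₁, h₂, h₃⟩

theorem ViaStep.tail {i j k : α} (h : ViaStep P₀ P₁ i j) (h' : ReflTransGen P₀ j k) :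
    ViaStep P₀ P₁ i k := by
  obtain ⟨x, y, h₁, h₂, h₃⟩ := h
  exact ⟨x, y, h₁, h₂, h₃.trans h'⟩

theorem ViaStep.single {i j : α} (h : P₁ i j) : ViaStep P₀ P₁ i j := ⟨i, j, .refl, h, .refl⟩

theorem ViaStep.transGen (h10 : ∀ i j, P₁ i j → P₀ i j) {i j : α} (h : ViaStep P₀ P₁ i j) :
    TransGen P₀ i j := by
  obtain ⟨x, y, h₁, h₂, h₃⟩ := h
  exact (TransGen.tail' h₁ (h10 x y h₂)).trans_left h₃

variable [LinearOrder α]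

/-- Follow the path from `i`: it reaches `j`, or some step jumps over `j`. The hypothesis applied to
that step yields a way into `j` or a strict step out of it, and the rest of the path completes the
latter. -/
theorem transGen_cross_left
    (hX : ∀ i j k, i < j → j < k → P₀ i k → P₀ i j ∨ P₁ j k) {i j k : α}
    (h : TransGen P₀ i k) (hij : i < j) (hjk : j < k) :
    TransGen P₀ i j ∨ ViaStep P₀ P₁ j k := by
  induction h using TransGen.head_induction_on with
  | single h => exact (hX _ _ _ hij hjk h).imp .single .single
  | @head i x hix hxk ih =>
    rcases lt_trichotomy x j with h | rfl | h
    · exact (ih h).imp_left fun h => h.head hix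
    · exact .inl (.single hix)
    · exact (hX _ _ _ hij h hix).imp .single fun h => (ViaStep.single h).tail hxk.to_reflTransGen

theorem transGen_cross_right
    (hX : ∀ i j k, i < j → j < k → P₀ i k → P₁ i j ∨ P₀ j k) {i j k : α}
    (h : TransGen P₀ i k) (hij : i < j) (hjk : j < k) :
    ViaStep P₀ P₁ i j ∨ TransGen P₀ j k := by
  induction h using TransGen.head_induction_on with
  | single h => exact (hX _ _ _ hij hjk h).imp .single .single
  | @head i x hix hxk ih =>
    rcases lt_trichotomy x j with h | rfl | h
    · exact (ih h).imp_left fun h => h.head (.single hix)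
    · exact .inr hxk
    · exact (hX _ _ _ hij h hix).imp .single fun h => hxk.head h

/-- The position of `j` relative to the strict step `x → y` decides whether `j` is crossed by the
path before it, by the step itself, or by the path after it. -/
theorem viaStep_cross
    (hX₁ : ∀ i j k, i < j → j < k → P₀ i k → P₀ i j ∨ P₁ j k)
    (hX₂ : ∀ i j k, i < j → j < k → P₀ i k → P₁ i j ∨ P₀ j k)
    (hX₃ : ∀ i j k, i < j → j < k → P₁ i k → P₁ i j ∨ P₁ j k) {i j k : α}
    (h : ViaStep P₀ P₁ i k) (hij : i < j) (hjk : j < k) :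
    ViaStep P₀ P₁ i j ∨ ViaStep P₀ P₁ j k := by
  obtain ⟨x, y, h₁, h₂, h₃⟩ := h
  rcases lt_trichotomy j x with h | rfl | h
  · rcases reflTransGen_iff_eq_or_transGen.1 h₁ with rfl | h₁
    · exact absurd h hij.asymm
    · exact (transGen_cross_right hX₂ h₁ hij h).imp_right
        fun h => ⟨x, y, h.to_reflTransGen, h₂, h₃⟩
  · exact .inr ⟨j, y, .refl, h₂, h₃⟩
  · rcases lt_trichotomy j y with h' | rfl | h'
    · exact (hX₃ _ _ _ h h' h₂).imp (fun h => ⟨x, j, h₁, h, .refl⟩) fun h => ⟨j, y, .refl, h, h₃⟩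
    · exact .inl ⟨x, j, h₁, h₂, .refl⟩
    · rcases reflTransGen_iff_eq_or_transGen.1 h₃ with rfl | h₃
      · exact absurd h' hjk.asymm
      · exact (transGen_cross_left hX₁ h₃ h' hjk).imp_left
          fun h => ⟨x, y, h₁, h₂, h.to_reflTransGen⟩

/-- The total preorder whose inversions are `TransGen P₀` and `ViaStep P₀ P₁`. -/
def JoinGE (P₀ P₁ : α → α → Prop) (i j : α) : Prop :=
  i = j ∨ (i < j ∧ TransGen P₀ i j) ∨ (j < i ∧ ¬ ViaStep P₀ P₁ j i)

theorem joinGE_total (h10 : ∀ i j, P₁ i j → P₀ i j) (i j : α) :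
    JoinGE P₀ P₁ i j ∨ JoinGE P₀ P₁ j i := by
  have key : ∀ i j, i < j → JoinGE P₀ P₁ i j ∨ JoinGE P₀ P₁ j i := by
    intro i j h
    by_cases hv : ViaStep P₀ P₁ i j
    · exact .inl (.inr (.inl ⟨h, hv.transGen h10⟩))
    · exact .inr (.inr (.inr ⟨h, hv⟩))
  rcases lt_trichotomy i j with h | rfl | h
  exacts [key i j h, .inl (.inl rfl), (key j i h).symm]

/-- Two inversions in the same direction compose, or are excluded by `viaStep_cross`. In the mixed
cases the middle position is outside the interval between the ends, and either crossing or extending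
a path settles the claim. -/
theorem joinGE_trans
    (hX₁ : ∀ i j k, i < j → j < k → P₀ i k → P₀ i j ∨ P₁ j k)
    (hX₂ : ∀ i j k, i < j → j < k → P₀ i k → P₁ i j ∨ P₀ j k)
    (hX₃ : ∀ i j k, i < j → j < k → P₁ i k → P₁ i j ∨ P₁ j k) {i j k : α}
    (h : JoinGE P₀ P₁ i j) (h' : JoinGE P₀ P₁ j k) : JoinGE P₀ P₁ i k := by
  rcases h with rfl | ⟨hij, h⟩ | ⟨hij, h⟩
  · exact h'
  · rcases h' with rfl | ⟨hjk, h'⟩ | ⟨hjk, h'⟩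
    · exact .inr (.inl ⟨hij, h⟩)
    · exact .inr (.inl ⟨hij.trans hjk, h.trans h'⟩)
    · rcases lt_trichotomy i k with hik | rfl | hik
      · exact .inr (.inl ⟨hik, (transGen_cross_left hX₁ h hik hjk).resolve_right h'⟩)
      · exact .inl rfl
      · exact .inr (.inr ⟨hik, fun hc => h' (hc.tail h.to_reflTransGen)⟩)
  · rcases h' with rfl | ⟨hjk, h'⟩ | ⟨hjk, h'⟩
    · exact .inr (.inr ⟨hij, h⟩)
    · rcases lt_trichotomy i k with hik | rfl | hik
      · exact .inr (.inl ⟨hik, (transGen_cross_right hX₂ h' hij hik).resolve_left h⟩)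
      · exact .inl rfl
      · exact .inr (.inr ⟨hik, fun hc => h (hc.head h'.to_reflTransGen)⟩)
    · exact .inr (.inr ⟨hjk.trans hij, fun hc =>
        (viaStep_cross hX₁ hX₂ hX₃ hc hjk hij).elim h' h⟩)

end Crossing

/-! ### The pseudo-permutohedron -/

theorem packedWord_le_iff {n : ℕ} {u v : PackedWord n} :
    u ≤ v ↔ ∀ i j, i < j → InvLE (u.1 i, v.1 i) (u.1 j, v.1 j) := by
  refine forall₃_congr fun i j _ => ?_
  simp only [inversion, InvLE]
  constructor
  · intro h
    constructor <;> intro h' <;> by_contra hc <;> split_ifs at h <;>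
      first | omega | norm_num at h
  · rintro ⟨h₁, h₂⟩
    split_ifs <;> first | omega | norm_num

/-! ### Packing arbitrary words, joins and meets -/

/-- The number of values of `f` which are at most `x`. -/
def valueRank {n : ℕ} (f : Fin n → ℕ) (x : ℕ) : ℕ :=
  ((Finset.univ.image f).filter (· ≤ x)).card

theorem valueRank_lt_valueRank {n : ℕ} {f : Fin n → ℕ} {x : ℕ} {j : Fin n} (h : x < f j) :
    valueRank f x < valueRank f (f j) := by
  refine Finset.card_lt_card (Finset.ssubset_iff_subset_ne.2 ⟨fun y hy => ?_, fun e => ?_⟩)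
  · simp only [Finset.mem_filter] at hy ⊢
    exact ⟨hy.1, hy.2.trans h.le⟩
  · have : f j ∈ (Finset.univ.image f).filter (· ≤ x) := by
      rw [e]
      simp
    simp only [Finset.mem_filter] at this
    omega

theorem exists_valueRank_eq {n : ℕ} (f : Fin n → ℕ) (i : Fin n) {m : ℕ} (hm : 1 ≤ m)
    (hle : m ≤ valueRank f (f i)) : ∃ j, valueRank f (f j) = m := by
  induction h : f i using Nat.strong_induction_on generalizing i with
  | _ N ih =>
    subst h
    rcases hle.eq_or_lt with rfl | hlt
    · exact ⟨i, rfl⟩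
    -- Passing to the next smaller value lowers the rank by exactly one, so no rank is skipped.
    have e : valueRank f (f i) = ((Finset.univ.image f).filter (· < f i)).card + 1 := by
      rw [← Finset.card_insert_of_notMem (a := f i) (by simp), valueRank]
      congr 1
      ext x
      simp only [Finset.mem_filter, Finset.mem_image, Finset.mem_univ, true_and,
        Finset.mem_insert, le_iff_lt_or_eq]
      constructor
      · rintro ⟨h₁, h₂ | h₂⟩
        exacts [.inr ⟨h₁, h₂⟩, .inl h₂]
      · rintro (rfl | ⟨h₁, h₂⟩)
        exacts [⟨⟨i, rfl⟩, .inr rfl⟩, ⟨h₁, .inl h₂⟩]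
    have hne : ((Finset.univ.image f).filter (· < f i)).Nonempty := by
      rw [← Finset.card_pos]
      omega
    obtain ⟨x, hx, hmax⟩ := Finset.exists_max_image _ id hne
    simp only [Finset.mem_filter, Finset.mem_image, Finset.mem_univ, true_and, id] at hx hmax
    obtain ⟨⟨j, rfl⟩, hj⟩ := hx
    refine ih (f j) hj j ?_ rfl
    have e' : (Finset.univ.image f).filter (· ≤ f j) =
        (Finset.univ.image f).filter (· < f i) := by
      ext x
      simp only [Finset.mem_filter, Finset.mem_image, Finset.mem_univ, true_and]
      exact and_congr_right fun hx => ⟨fun h => h.trans_lt hj, fun h => hmax x ⟨hx, h⟩⟩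
    rw [valueRank, e']
    omega

/-- The packed word with the same comparisons between letters as `f`. -/
def pack {n : ℕ} (f : Fin n → ℕ) : PackedWord n :=
  ⟨fun i => valueRank f (f i), fun i => Finset.card_pos.2 ⟨f i, by simp⟩,
    fun i _ hm hle => exists_valueRank_eq f i hm hle⟩

theorem pack_lt_pack {n : ℕ} {f : Fin n → ℕ} {i j : Fin n} (h : f i < f j) :
    (pack f).1 i < (pack f).1 j := valueRank_lt_valueRank h

theorem pack_le_iff {n : ℕ} {f : Fin n → ℕ} {i j : Fin n} :
    (pack f).1 i ≤ (pack f).1 j ↔ f i ≤ f j := by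
  constructor
  · intro h
    by_contra hc
    have := pack_lt_pack (not_le.1 hc)
    omega
  · intro h
    rcases h.eq_or_lt with h | h
    · exact (congrArg (valueRank f) h).le
    · exact (pack_lt_pack h).le

theorem tree_pack {n : ℕ} (f : Fin n → ℕ) : tree (pack f) = treeOfList (List.ofFn f) := by
  have e : List.ofFn (pack f).1 = (List.ofFn f).map (valueRank f) := by
    rw [List.map_ofFn]
    rfl
  rw [tree, e]
  refine treeOfList_map ?_
  intro x hx y hy hxy
  obtain ⟨i, rfl⟩ := (List.mem_ofFn' f x).1 hx
  obtain ⟨j, rfl⟩ := (List.mem_ofFn' f y).1 hy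
  exact valueRank_lt_valueRank hxy

/-- The letter at `i` counts the positions below `i`, a number that is monotone by transitivity and
strictly so by totality; packing then closes the gaps. -/
theorem exists_packedWord_of_total {n : ℕ} {G : Fin n → Fin n → Prop}
    (ht : ∀ i j, G i j ∨ G j i) (htr : ∀ i j k, G i j → G j k → G i k) :
    ∃ w : PackedWord n, ∀ i j, w.1 j ≤ w.1 i ↔ G i j := by
  classical
  refine ⟨pack fun i => (Finset.univ.filter (G i)).card, fun i j => ?_⟩
  rw [pack_le_iff]
  constructor
  · intro h
    by_contra hc
    have hji := (ht i j).resolve_left hc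
    refine absurd h (not_le.2 (Finset.card_lt_card
      (Finset.ssubset_iff_subset_ne.2 ⟨fun k hk => ?_, fun e => ?_⟩)))
    · simp only [Finset.mem_filter, Finset.mem_univ, true_and] at hk ⊢
      exact htr _ _ _ hji hk
    · have : j ∈ Finset.univ.filter (G i) := by
        rw [e]
        simpa using ht j j
      simp only [Finset.mem_filter, Finset.mem_univ, true_and] at this
      exact hc this
  · intro h
    refine Finset.card_le_card fun k hk => ?_
    simp only [Finset.mem_filter, Finset.mem_univ, true_and] at hk ⊢
    exact htr _ _ _ h hk

/-- An upper bound must contain the weak inversions `P₀` of `u` or `v`, hence their transitive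
closure, and must be strict along any path with a step in `P₁`. These forced inversions already
define a word. -/
theorem exists_isLUB_packedWord {n : ℕ} (u v : PackedWord n) : ∃ w, IsLUB {u, v} w := by
  set P₀ : Fin n → Fin n → Prop := fun i j => i < j ∧ (u.1 j ≤ u.1 i ∨ v.1 j ≤ v.1 i) with hP₀
  set P₁ : Fin n → Fin n → Prop := fun i j => i < j ∧ (u.1 j < u.1 i ∨ v.1 j < v.1 i) with hP₁
  have h10 : ∀ i j, P₁ i j → P₀ i j := fun i j h => ⟨h.1, h.2.imp le_of_lt le_of_lt⟩
  obtain ⟨w, hw⟩ := exists_packedWord_of_total (joinGE_total h10)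
    (fun i j k => joinGE_trans
      -- The crossing conditions hold for `u` and `v` separately, being comparisons of three
      -- letters, and hence for the union.
      (fun i j k hij hjk h => by simp only [hP₀, hP₁, hij, hjk, true_and] at h ⊢; omega)
      (fun i j k hij hjk h => by simp only [hP₀, hP₁, hij, hjk, true_and] at h ⊢; omega)
      (fun i j k hij hjk h => by simp only [hP₁, hij, hjk, true_and] at h ⊢; omega))
  have hw₀ : ∀ i j, i < j → (w.1 j ≤ w.1 i ↔ Relation.TransGen P₀ i j) := by
    intro i j h
    rw [hw, JoinGE]
    simp [h, h.ne, h.asymm]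
  have hw₁ : ∀ i j, i < j → (w.1 j < w.1 i ↔ ViaStep P₀ P₁ i j) := by
    intro i j h
    rw [← not_le, hw, JoinGE]
    simp [h, h.ne', h.asymm]
  refine ⟨w, ?_, ?_⟩
  · rintro x (rfl | rfl) <;> refine packedWord_le_iff.2 fun i j hij => ⟨fun h => ?_, fun h => ?_⟩
    · exact (hw₀ i j hij).2 (.single ⟨hij, .inl h⟩)
    · exact (hw₁ i j hij).2 (.single ⟨hij, .inl h⟩)
    · exact (hw₀ i j hij).2 (.single ⟨hij, .inr h⟩)
    · exact (hw₁ i j hij).2 (.single ⟨hij, .inr h⟩)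
  · intro x hx
    have hu := packedWord_le_iff.1 (hx (Set.mem_insert u _))
    have hv := packedWord_le_iff.1 (hx (Set.mem_insert_of_mem u rfl))
    have h₀ : ∀ i j, P₀ i j → x.1 j ≤ x.1 i := fun i j h =>
      h.2.elim (hu i j h.1).1 (hv i j h.1).1
    have h₁ : ∀ i j, P₁ i j → x.1 j < x.1 i := fun i j h =>
      h.2.elim (hu i j h.1).2 (hv i j h.1).2
    have hr : ∀ i j, Relation.ReflTransGen P₀ i j → x.1 j ≤ x.1 i := by
      intro i j h
      induction h with
      | refl => exact le_rfl
      | tail _ h ih => exact (h₀ _ _ h).trans ih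
    refine packedWord_le_iff.2 fun i j hij => ⟨fun h => ?_, fun h => ?_⟩
    · exact hr i j ((hw₀ i j hij).1 h).to_reflTransGen
    · obtain ⟨y, z, hy, hyz, hz⟩ := (hw₁ i j hij).1 h
      exact (hr _ _ hz).trans_lt ((h₁ _ _ hyz).trans_le (hr _ _ hy))

/-- The packed word read from right to left. -/
def PackedWord.reverse {n : ℕ} (w : PackedWord n) : PackedWord n :=
  ⟨w.1 ∘ Fin.rev, fun i => w.2.1 _, fun i m h₁ h₂ => by
    obtain ⟨j, hj⟩ := w.2.2 _ m h₁ h₂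
    exact ⟨j.rev, by simp [hj]⟩⟩

theorem PackedWord.reverse_reverse {n : ℕ} (w : PackedWord n) : w.reverse.reverse = w :=
  Subtype.ext (funext fun i => by simp [reverse])

/-- Reversal exchanges full inversions with non-inversions, so it reverses the order and turns joins
into meets. -/
theorem PackedWord.reverse_le_reverse {n : ℕ} {u v : PackedWord n} (h : u ≤ v) :
    v.reverse ≤ u.reverse := by
  refine packedWord_le_iff.2 fun i j hij => ?_
  have := packedWord_le_iff.1 h j.rev i.rev (Fin.rev_lt_rev.2 hij)
  simp only [InvLE, reverse, Function.comp_apply] at this ⊢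
  omega

theorem exists_isGLB_packedWord {n : ℕ} (u v : PackedWord n) : ∃ w, IsGLB {u, v} w := by
  obtain ⟨w, hw₁, hw₂⟩ := exists_isLUB_packedWord u.reverse v.reverse
  have hu := PackedWord.reverse_le_reverse (hw₁ (Set.mem_insert _ _))
  have hv := PackedWord.reverse_le_reverse (hw₁ (Set.mem_insert_of_mem _ rfl))
  rw [PackedWord.reverse_reverse] at hu hv
  refine ⟨w.reverse, ?_, fun x hx => ?_⟩
  · rintro x (rfl | rfl)
    exacts [hu, hv]
  · rw [← x.reverse_reverse]
    refine PackedWord.reverse_le_reverse (hw₂ ?_)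
    rintro y (rfl | rfl)
    exacts [PackedWord.reverse_le_reverse (hx (Set.mem_insert _ _)),
      PackedWord.reverse_le_reverse (hx (Set.mem_insert_of_mem _ rfl))]

/-! ### The three orders on classes -/

theorem leaves_tree {n : ℕ} (w : PackedWord n) : (tree w).leaves = n + 1 := by
  rw [tree, leaves_treeOfList, List.length_ofFn]

theorem tree_le_tree {n : ℕ} {u v : PackedWord n} (h : u ≤ v) :
    PalaciosRoncoLE (tree u) (tree v) := by
  have := treeOfList_le_of_pairwise (z := List.ofFn fun i => (u.1 i, v.1 i))
    (List.pairwise_ofFn.2 fun i j hij => packedWord_le_iff.1 h i j hij)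
  rw [List.map_ofFn, List.map_ofFn] at this
  exact this

theorem eq_ofFn_of_map {n : ℕ} {f g : Fin n → ℕ} {z : List (ℕ × ℕ)}
    (h₁ : z.map Prod.fst = List.ofFn f) (h₂ : z.map Prod.snd = List.ofFn g) :
    z = List.ofFn fun i => (f i, g i) := by
  rw [List.zip_of_prod h₁ h₂]
  refine List.ext_getElem (by simp) fun i hi hi' => by simp

theorem exists_eq_ofFn_of_realizable {n : ℕ} {t t' : PlaneTree} (h : Realizable t t')
    (ht : t.leaves = n + 1) : ∃ f g : Fin n → ℕ, (∀ i j, i < j → InvLE (f i, g i) (f j, g j)) ∧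
      IsMaxWord (List.ofFn f) ∧ treeOfList (List.ofFn f) = t ∧ treeOfList (List.ofFn g) = t' := by
  obtain ⟨z, hz, hmax, rfl, rfl⟩ := h
  rw [leaves_treeOfList, List.length_map] at ht
  obtain rfl : z.length = n := by omega
  have e : z = List.ofFn z.get := (List.ofFn_get z).symm
  have e₁ : z.map Prod.fst = List.ofFn fun i => (z.get i).1 := by
    conv_lhs => rw [e, List.map_ofFn]
    rfl
  have e₂ : z.map Prod.snd = List.ofFn fun i => (z.get i).2 := by
    conv_lhs => rw [e, List.map_ofFn]
    rfl
  refine ⟨_, _, fun i j hij => ?_, e₁ ▸ hmax, by rw [e₁], by rw [e₂]⟩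
  rw [e] at hz
  exact List.pairwise_ofFn.1 hz hij

theorem pack_le_pack {n : ℕ} {f g : Fin n → ℕ} (h : ∀ i j, i < j → InvLE (f i, g i) (f j, g j)) :
    pack f ≤ pack g := by
  refine packedWord_le_iff.2 fun i j hij => ?_
  have := h i j hij
  simp only [InvLE] at this ⊢
  rw [← not_le, ← not_le, pack_le_iff, pack_le_iff, pack_le_iff, pack_le_iff]
  omega

theorem le_pack_of_isMaxWord {n : ℕ} {f : Fin n → ℕ} (hf : IsMaxWord (List.ofFn f))
    {w : PackedWord n} (hw : tree w = treeOfList (List.ofFn f)) : w ≤ pack f := by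
  obtain ⟨z, h₁, h₂, hz⟩ := hf _ hw
  rw [eq_ofFn_of_map h₁ h₂] at hz
  refine packedWord_le_iff.2 fun i j hij => ?_
  have := List.pairwise_ofFn.1 hz hij
  simp only [InvLE] at this ⊢
  rw [← not_le (a := (pack f).1 i), pack_le_iff, pack_le_iff]
  omega

theorem exists_greatest_of_leaves {n : ℕ} {t : PlaneTree} (ht : t.leaves = n + 1) :
    ∃ w : PackedWord n, tree w = t ∧ ∀ w' : PackedWord n, tree w' = t → w' ≤ w := by
  obtain ⟨f, g, -, hmax, rfl, -⟩ := exists_eq_ofFn_of_realizable (.refl t) ht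
  exact ⟨pack f, tree_pack f, fun w' h => le_pack_of_isMaxWord hmax h⟩

/-- At each move the word reached so far is below the maximal word of its class, which is the lower
member of the pair realizing the move. -/
theorem exists_le_of_palaciosRoncoLE {n : ℕ} {u : PackedWord n} {t : PlaneTree}
    (h : PalaciosRoncoLE (tree u) t) : ∃ v : PackedWord n, tree v = t ∧ u ≤ v := by
  induction h with
  | refl => exact ⟨u, rfl, le_rfl⟩
  | tail _ h ih =>
    obtain ⟨v, rfl, huv⟩ := ih
    obtain ⟨f, g, hfg, hmax, e, rfl⟩ :=
      exists_eq_ofFn_of_realizable (.of_move h) (leaves_tree v)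
    exact ⟨pack g, tree_pack g,
      huv.trans ((le_pack_of_isMaxWord hmax e.symm).trans (pack_le_pack hfg))⟩

/-! ### Classes, canonical words and the equivalence of the orders -/

namespace TreeClass

variable {n : ℕ}

theorem mem_words {S : TreeClass n} {w : PackedWord n} : w ∈ S.words ↔ tree w = S.planeTree := by
  induction S using Quotient.inductionOn with
  | _ v => exact Quotient.eq (r := treeSetoid n)

theorem leaves_planeTree (S : TreeClass n) : S.planeTree.leaves = n + 1 := by
  induction S using Quotient.inductionOn with
  | _ v => exact leaves_tree v

theorem planeTree_injective : Function.Injective (planeTree (n := n)) := by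
  intro S S' h
  induction S using Quotient.inductionOn with
  | _ v =>
    induction S' using Quotient.inductionOn with
    | _ v' => exact Quotient.sound (s := treeSetoid n) h

theorem exists_isCanonical (S : TreeClass n) : ∃ w, S.IsCanonical w := by
  obtain ⟨w, hw, hmax⟩ := exists_greatest_of_leaves S.leaves_planeTree
  exact ⟨w, mem_words.2 hw, fun w' hw' => hmax w' (mem_words.1 hw')⟩

theorem bijOn_planeTree :
    Set.BijOn planeTree (Set.univ : Set (TreeClass n)) {T | T.leaves = n + 1} := by
  refine ⟨fun S _ => S.leaves_planeTree, planeTree_injective.injOn, fun t ht => ?_⟩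
  obtain ⟨w, hw, -⟩ := exists_greatest_of_leaves ht
  exact ⟨Quotient.mk (treeSetoid n) w, trivial, hw⟩

theorem CanonicalLE.pairLE {S S' : TreeClass n} (h : S.CanonicalLE S') : S.PairLE S' := by
  obtain ⟨w, w', h₁, h₂, h⟩ := h
  exact ⟨w, h₁.1, w', h₂.1, h⟩

theorem PairLE.palaciosRoncoLE {S S' : TreeClass n} (h : S.PairLE S') :
    PalaciosRoncoLE S.planeTree S'.planeTree := by
  obtain ⟨w, h₁, w', h₂, h⟩ := h
  rw [← mem_words.1 h₁, ← mem_words.1 h₂]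
  exact tree_le_tree h

theorem canonicalLE_of_palaciosRoncoLE {S S' : TreeClass n}
    (h : PalaciosRoncoLE S.planeTree S'.planeTree) : S.CanonicalLE S' := by
  obtain ⟨w, hw⟩ := S.exists_isCanonical
  obtain ⟨w', hw'⟩ := S'.exists_isCanonical
  rw [← mem_words.1 hw.1] at h
  obtain ⟨v, hv, hwv⟩ := exists_le_of_palaciosRoncoLE h
  exact ⟨w, w', hw, hw', hwv.trans (hw'.2 (mem_words.2 hv))⟩

theorem isPartialOrder_canonicalLE : IsPartialOrder (TreeClass n) CanonicalLE where
  refl S := by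
    obtain ⟨w, hw⟩ := S.exists_isCanonical
    exact ⟨w, w, hw, hw, le_rfl⟩
  trans _ _ _ := by
    rintro ⟨a, b, ha, hb, hab⟩ ⟨b', c, hb', hc, hbc⟩
    exact ⟨a, c, ha, hc, hab.trans ((hb.unique hb').le.trans hbc)⟩
  antisymm S S' := by
    rintro ⟨a, b, ha, hb, hab⟩ ⟨b', a', hb', ha', hba⟩
    obtain rfl := ha.unique ha'
    obtain rfl := hb.unique hb'
    obtain rfl := le_antisymm hab hba
    exact (ha.1 : _ = S).symm.trans hb.1

end TreeClass

/-- The least canonical word above `x` is that of its class: if `x` is below a canonical word `d`,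
the two classes are comparable through the pair `x`, `d`, hence so are their canonical words. -/
theorem exists_canonicalWord {n : ℕ} (x : PackedWord n) :
    ∃ c : CanonicalWord n, x ≤ c.1 ∧ ∀ d : CanonicalWord n, x ≤ d.1 → c ≤ d := by
  obtain ⟨c, hc⟩ := TreeClass.exists_isCanonical (Quotient.mk (treeSetoid n) x)
  refine ⟨⟨c, _, hc⟩, hc.2 rfl, ?_⟩
  rintro ⟨d, S, hd⟩ hxd
  have hp : TreeClass.PairLE (Quotient.mk (treeSetoid n) x) S := ⟨x, rfl, d, hd.1, hxd⟩
  obtain ⟨c', d', hc', hd', h⟩ := TreeClass.canonicalLE_of_palaciosRoncoLE hp.palaciosRoncoLE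
  obtain rfl := hc.unique hc'
  obtain rfl := hd.unique hd'
  exact h

theorem exists_isLUB_canonicalWord {n : ℕ} (u v : CanonicalWord n) : ∃ s, IsLUB {u, v} s := by
  obtain ⟨x, hx₁, hx₂⟩ := exists_isLUB_packedWord u.1 v.1
  obtain ⟨c, hc₁, hc₂⟩ := exists_canonicalWord x
  refine ⟨c, ?_, fun d hd => hc₂ d (hx₂ ?_)⟩
  · rintro y (rfl | rfl)
    · exact (hx₁ (Set.mem_insert _ _)).trans hc₁
    · exact (hx₁ (Set.mem_insert_of_mem _ rfl)).trans hc₁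
  · rintro y (rfl | rfl)
    · exact hd (Set.mem_insert _ _)
    · exact hd (Set.mem_insert_of_mem _ rfl)

theorem exists_isGLB_canonicalWord {n : ℕ} (u v : CanonicalWord n) : ∃ t, IsGLB {u, v} t := by
  obtain ⟨x, hx₁, hx₂⟩ := exists_isGLB_packedWord u.1 v.1
  obtain ⟨c, hc₁, hc₂⟩ := exists_canonicalWord x
  -- The closure of the meet stays below `u` and `v`, because both are canonical.
  refine ⟨c, ?_, fun d hd => (hx₂ ?_ : d.1 ≤ x).trans hc₁⟩
  · rintro y (rfl | rfl)
    · exact hc₂ _ (hx₁ (Set.mem_insert _ _))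
    · exact hc₂ _ (hx₁ (Set.mem_insert_of_mem _ rfl))
  · rintro y (rfl | rfl)
    · exact hd (Set.mem_insert _ _)
    · exact hd (Set.mem_insert_of_mem _ rfl)

end PackedTrees

theorem mainTheorem11 (n : ℕ) :
    -- every class has a unique maximal word, and the classes are indexed by the plane trees
    (∀ S : PackedTrees.TreeClass n, ∃ w, S.IsCanonical w) ∧
    Set.BijOn PackedTrees.TreeClass.planeTree
      (Set.univ : Set (PackedTrees.TreeClass n)) {T | T.leaves = n + 1} ∧
    -- the first relation is a partial order and coincides with the two others
    IsPartialOrder (PackedTrees.TreeClass n) PackedTrees.TreeClass.CanonicalLE ∧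
    (∀ S S' : PackedTrees.TreeClass n, S.CanonicalLE S' ↔ S.PairLE S') ∧
    (∀ S S' : PackedTrees.TreeClass n, S.CanonicalLE S' ↔
      PackedTrees.PlaneTree.PalaciosRoncoLE S.planeTree S'.planeTree) ∧
    -- the canonical words form a lattice for the induced order
    ∀ u v : PackedTrees.CanonicalWord n,
      (∃ s, IsLUB {u, v} s) ∧ ∃ t, IsGLB {u, v} t := by
  refine ⟨fun S => S.exists_isCanonical, PackedTrees.TreeClass.bijOn_planeTree,
    PackedTrees.TreeClass.isPartialOrder_canonicalLE, fun S S' => ⟨fun h => h.pairLE, fun h => ?_⟩,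
    fun S S' => ⟨fun h => h.pairLE.palaciosRoncoLE, fun h => ?_⟩, fun u v => ⟨?_, ?_⟩⟩
  · exact PackedTrees.TreeClass.canonicalLE_of_palaciosRoncoLE h.palaciosRoncoLE
  · exact PackedTrees.TreeClass.canonicalLE_of_palaciosRoncoLE h
  · exact PackedTrees.exists_isLUB_canonicalWord u v
  · exact PackedTrees.exists_isGLB_canonicalWord u v
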